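/- Let $A$ be a unital $C^*$-algebra and let $\alpha\colon\mathbb{T}\to\mathrm{Aut}(A)$ be a (point-norm) continuous action of the circle with the Rokhlin property: for every $\varepsilon>0$ and every finite subset $F\subseteq A$ there is a unitary $u\in A$ such that $\|\alpha_\zeta(u)-\zeta u\|<\varepsilon$ for all $\zeta\in\mathbb{T}$ and $\|ua-au\|<\varepsilon$ for all $a\in F$. Let $A^\alpha=\{a\in A:\alpha_\zeta(a)=a \text{ for all } \zeta\in\mathbb{T}\}$ be the fixed point algebra and let $\iota\colon A^\alpha\hookrightarrow A$ be the inclusion. Then: \begin{enumerate} \item For $j=0,1$, the group homomorphism $K_j(\iota)\colon K_j(A^\alpha)\to K_j(A)$ is injective. \item For each $j\in\{0,1\}$ such that $K_j(A)$ is finitely generated, there exists a group homomorphism $\pi\colon K_j(A)\to K_j(A^\alpha)$ such that $\pi\circ K_j(\iota)=\mathrm{id}_{K_j(A^\alpha)}$. \item For $j=0,1$, without any finite generation assumption, the image $K_j(\iota)(K_j(A^\alpha))$ is a pure subgroup of $K_j(A)$, where a subgroup $G'$ of an abelian group $G$ is called pure if every torsion element of $G/G'$ lifts to a torsion element of $G$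 of the same order. \end{enumerate} -/

import Mathlib

open scoped Matrix CStarAlgebra

noncomputable section

/-! ### Murray–von Neumann equivalence and `K₀` -/

namespace CStarK

section Projections

variable {A : Type*} [CStarAlgebra A]

/-- Murray–von Neumann equivalence of square matrices `p`, `q` (possibly of different sizes) over
`A`: there is a rectangular matrix `v` with `v v* = p` and `v* v = q`. -/
def MvN {m n : Type*} [Fintype m] [Fintype n] (p : Matrix m m A) (q : Matrix n n A) : Prop :=
  ∃ v : Matrix m n A, v * vᴴ = p ∧ vᴴ * v = q

/-- The block diagonal sum `diag(p, q)`. -/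
def dsum {m n : ℕ} (p : Matrix (Fin m) (Fin m) A) (q : Matrix (Fin n) (Fin n) A) :
    Matrix (Fin (m + n)) (Fin (m + n)) A :=
  Matrix.reindex finSumFinEquiv finSumFinEquiv (Matrix.fromBlocks p 0 0 q)

variable (A) in
/-- All projections in all matrix algebras `M_n(A)`. -/
def Proj : Type _ := Σ n : ℕ, {p : Matrix (Fin n) (Fin n) A // IsStarProjection p}

section lemmas

variable {l m n k : Type*} [Fintype l] [Fintype m] [Fintype n] [Fintype k]

lemma MvN.refl {p : Matrix m m A} (hp : IsStarProjection p) : MvN p p := by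
  have h1 : pᴴ = p := hp.isSelfAdjoint
  exact ⟨p, by rw [h1]; exact hp.isIdempotentElem, by rw [h1]; exact hp.isIdempotentElem⟩

lemma MvN.symm {p : Matrix m m A} {q : Matrix n n A} (h : MvN p q) : MvN q p := by
  obtain ⟨v, h1, h2⟩ := h
  exact ⟨vᴴ, by simpa using h2, by simpa using h1⟩

lemma MvN.trans {p : Matrix l l A} {q : Matrix m m A} {r : Matrix n n A}
    (hp : IsStarProjection p) (hr : IsStarProjection r) (h : MvN p q) (h' : MvN q r) :
    MvN p r := by
  obtain ⟨v, h1, h2⟩ := h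
  obtain ⟨w, h3, h4⟩ := h'
  refine ⟨v * w, ?_, ?_⟩
  · calc v * w * (v * w)ᴴ = v * (w * wᴴ) * vᴴ := by
          simp only [Matrix.conjTranspose_mul, Matrix.mul_assoc]
      _ = (v * vᴴ) * (v * vᴴ) := by rw [h3, ← h2]; simp only [Matrix.mul_assoc]
      _ = p := by rw [h1]; exact hp.isIdempotentElem
  · calc (v * w)ᴴ * (v * w) = wᴴ * (vᴴ * v) * w := by
          simp only [Matrix.conjTranspose_mul, Matrix.mul_assoc]
      _ = (wᴴ * w) * (wᴴ * w) := by rw [h2, ← h3]; simp only [Matrix.mul_assoc]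
      _ = r := by rw [h4]; exact hr.isIdempotentElem

lemma MvN.reindex {p : Matrix m m A} (hp : IsStarProjection p) (e : m ≃ n) :
    MvN p (Matrix.reindex e e p) := by
  have h1 : pᴴ = p := hp.isSelfAdjoint
  have h2 : p * p = p := hp.isIdempotentElem
  refine ⟨p.submatrix id e.symm, ?_, ?_⟩
  · rw [Matrix.conjTranspose_submatrix, h1, Matrix.submatrix_mul_equiv, h2]; rfl
  · rw [Matrix.conjTranspose_submatrix, h1]
    have := Matrix.submatrix_mul_equiv p p e.symm (Equiv.refl m) e.symm
    simp only [Equiv.coe_refl] at this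
    rw [this, h2]; rfl

lemma MvN.blocks {p : Matrix l l A} {q : Matrix m m A} {r : Matrix n n A} {s : Matrix k k A}
    (h : MvN p q) (h' : MvN r s) :
    MvN (Matrix.fromBlocks p 0 0 r) (Matrix.fromBlocks q 0 0 s) := by
  obtain ⟨v, rfl, rfl⟩ := h
  obtain ⟨w, rfl, rfl⟩ := h'
  exact ⟨Matrix.fromBlocks v 0 0 w,
    by simp [Matrix.fromBlocks_conjTranspose, Matrix.fromBlocks_multiply],
    by simp [Matrix.fromBlocks_conjTranspose, Matrix.fromBlocks_multiply]⟩

lemma isStarProjection_reindex {p : Matrix m m A} (hp : IsStarProjection p) (e : m ≃ n) :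
    IsStarProjection (Matrix.reindex e e p) := by
  have h1 : pᴴ = p := hp.isSelfAdjoint
  have h2 : p * p = p := hp.isIdempotentElem
  refine ⟨?_, ?_⟩
  · change Matrix.reindex e e p * Matrix.reindex e e p = Matrix.reindex e e p
    rw [Matrix.reindex_apply, Matrix.submatrix_mul_equiv, h2]
  · change (Matrix.reindex e e p)ᴴ = Matrix.reindex e e p
    rw [Matrix.conjTranspose_reindex, h1]

lemma isStarProjection_blocks {p : Matrix m m A} {q : Matrix n n A} (hp : IsStarProjection p)
    (hq : IsStarProjection q) : IsStarProjection (Matrix.fromBlocks p 0 0 q) := by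
  have h1 : pᴴ = p := hp.isSelfAdjoint
  have h2 : p * p = p := hp.isIdempotentElem
  have h3 : qᴴ = q := hq.isSelfAdjoint
  have h4 : q * q = q := hq.isIdempotentElem
  refine ⟨?_, ?_⟩
  · simp [IsIdempotentElem, Matrix.fromBlocks_multiply, h2, h4]
  · change (Matrix.fromBlocks p 0 0 q)ᴴ = Matrix.fromBlocks p 0 0 q
    simp [Matrix.fromBlocks_conjTranspose, h1, h3]

end lemmas

lemma isStarProjection_dsum {m n : ℕ} {p : Matrix (Fin m) (Fin m) A} {q : Matrix (Fin n) (Fin n) A}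
    (hp : IsStarProjection p) (hq : IsStarProjection q) : IsStarProjection (dsum p q) :=
  isStarProjection_reindex (isStarProjection_blocks hp hq) _

lemma MvN.dsum_blocks {m n : ℕ} {p : Matrix (Fin m) (Fin m) A} {q : Matrix (Fin n) (Fin n) A}
    (hp : IsStarProjection p) (hq : IsStarProjection q) :
    MvN (dsum p q) (Matrix.fromBlocks p 0 0 q) :=
  (MvN.reindex (isStarProjection_blocks hp hq) _).symm

lemma MvN.dsum_congr {m n m' n' : ℕ} {p : Matrix (Fin m) (Fin m) A} {q : Matrix (Fin n) (Fin n) A}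
    {p' : Matrix (Fin m') (Fin m') A} {q' : Matrix (Fin n') (Fin n') A}
    (hp : IsStarProjection p) (hq : IsStarProjection q) (hp' : IsStarProjection p')
    (hq' : IsStarProjection q') (h : MvN p p') (h' : MvN q q') :
    MvN (dsum p q) (dsum p' q') := by
  have h1 := isStarProjection_dsum hp hq
  have h2 := isStarProjection_dsum hp' hq'
  exact ((MvN.dsum_blocks hp hq).trans h1 (isStarProjection_blocks hp' hq')
    (h.blocks h')).trans h1 h2 (MvN.dsum_blocks hp' hq').symm

variable (A) in
/-- Murray–von Neumann equivalence on the projections in matrix algebras over `A`. -/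
instance projSetoid : Setoid (Proj A) where
  r p q := MvN p.2.1 q.2.1
  iseqv := ⟨fun p => MvN.refl p.2.2, fun h => h.symm, fun {p _ r} h h' =>
    h.trans p.2.2 r.2.2 h'⟩

variable (A) in
/-- The semigroup `V(A)` of Murray–von Neumann classes of projections in matrix algebras over `A`,
with addition induced by block diagonal sum. -/
def V : Type _ := Quotient (projSetoid A)

namespace V

/-- The class of a projection in `M_n(A)`. -/
def mk {n : ℕ} (p : Matrix (Fin n) (Fin n) A) (hp : IsStarProjection p) : V A :=
  Quotient.mk (projSetoid A) ⟨n, p, hp⟩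

instance : Zero (V A) := ⟨mk (0 : Matrix (Fin 0) (Fin 0) A) (IsStarProjection.zero _)⟩

instance : Add (V A) :=
  ⟨Quotient.map₂ (fun p q => ⟨p.1 + q.1, dsum p.2.1 q.2.1, isStarProjection_dsum p.2.2 q.2.2⟩)
    (fun p p' h q q' h' => MvN.dsum_congr p.2.2 q.2.2 p'.2.2 q'.2.2 h h')⟩

lemma mk_add_mk {m n : ℕ} (p : Matrix (Fin m) (Fin m) A) (q : Matrix (Fin n) (Fin n) A)
    (hp : IsStarProjection p) (hq : IsStarProjection q) :
    mk p hp + mk q hq = mk (dsum p q) (isStarProjection_dsum hp hq) := rfl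

lemma mk_eq_mk {m n : ℕ} {p : Matrix (Fin m) (Fin m) A} {q : Matrix (Fin n) (Fin n) A}
    {hp : IsStarProjection p} {hq : IsStarProjection q} :
    mk p hp = mk q hq ↔ MvN p q :=
  Quotient.eq (r := projSetoid A)

lemma ind {P : V A → Prop} (h : ∀ (n : ℕ) (p : Matrix (Fin n) (Fin n) A) (hp), P (mk p hp))
    (x : V A) : P x :=
  Quotient.ind (fun p => h p.1 p.2.1 p.2.2) x

lemma add_comm' (x y : V A) : x + y = y + x := by
  induction x using V.ind with | _ m p hp
  induction y using V.ind with | _ n q hq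
  rw [mk_add_mk, mk_add_mk, mk_eq_mk]
  have h := MvN.reindex (isStarProjection_blocks hp hq) (Equiv.sumComm _ _)
  have e : Matrix.reindex (Equiv.sumComm (Fin m) (Fin n)) (Equiv.sumComm (Fin m) (Fin n))
      (Matrix.fromBlocks p 0 0 q) = Matrix.fromBlocks q 0 0 p := by
    ext (i | i) (j | j) <;> rfl
  rw [e] at h
  have h1 := isStarProjection_dsum hp hq
  exact ((MvN.dsum_blocks hp hq).trans h1 (isStarProjection_blocks hq hp) h).trans h1
    (isStarProjection_dsum hq hp) (MvN.dsum_blocks hq hp).symm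

lemma zero_add' (x : V A) : 0 + x = x := by
  induction x using V.ind with | _ n p hp
  change mk _ (IsStarProjection.zero _) + mk p hp = mk p hp
  rw [mk_add_mk, mk_eq_mk]
  have h0 : IsStarProjection (0 : Matrix (Fin 0) (Fin 0) A) := IsStarProjection.zero _
  have h := MvN.reindex (isStarProjection_blocks h0 hp) (Equiv.emptySum _ _)
  have e : Matrix.reindex (Equiv.emptySum (Fin 0) (Fin n)) (Equiv.emptySum (Fin 0) (Fin n))
      (Matrix.fromBlocks 0 0 0 p) = p := by
    ext i j; rfl
  rw [e] at h
  exact (MvN.dsum_blocks h0 hp).trans (isStarProjection_dsum h0 hp) hp h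

lemma add_assoc' (x y z : V A) : x + y + z = x + (y + z) := by
  induction x using V.ind with | _ l p hp
  induction y using V.ind with | _ m q hq
  induction z using V.ind with | _ n r hr
  simp only [mk_add_mk, mk_eq_mk]
  have hpq := isStarProjection_dsum hp hq
  have hqr := isStarProjection_dsum hq hr
  have b1 := isStarProjection_blocks (isStarProjection_blocks hp hq) hr
  have b2 := isStarProjection_blocks hp (isStarProjection_blocks hq hr)
  have h1 : MvN (dsum (dsum p q) r) (Matrix.fromBlocks (Matrix.fromBlocks p 0 0 q) 0 0 r) :=
    (MvN.dsum_blocks hpq hr).trans (isStarProjection_dsum hpq hr) b1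
      ((MvN.dsum_blocks hp hq).blocks (MvN.refl hr))
  have h2 : MvN (dsum p (dsum q r)) (Matrix.fromBlocks p 0 0 (Matrix.fromBlocks q 0 0 r)) :=
    (MvN.dsum_blocks hp hqr).trans (isStarProjection_dsum hp hqr) b2
      ((MvN.refl hp).blocks (MvN.dsum_blocks hq hr))
  have h := MvN.reindex b1 (Equiv.sumAssoc _ _ _)
  have e : Matrix.reindex (Equiv.sumAssoc (Fin l) (Fin m) (Fin n))
      (Equiv.sumAssoc (Fin l) (Fin m) (Fin n))
      (Matrix.fromBlocks (Matrix.fromBlocks p 0 0 q) 0 0 r) =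
      Matrix.fromBlocks p 0 0 (Matrix.fromBlocks q 0 0 r) := by
    ext (i | i | i) (j | j | j) <;> rfl
  rw [e] at h
  have d1 := isStarProjection_dsum hpq hr
  exact (h1.trans d1 b2 h).trans d1 (isStarProjection_dsum hp hqr) h2.symm

instance : AddCommMonoid (V A) where
  add_assoc := add_assoc'
  zero_add := zero_add'
  add_zero x := by rw [add_comm', zero_add']
  add_comm := add_comm'
  nsmul := nsmulRec

end V

variable {B : Type*} [CStarAlgebra B]

/-- Entrywise application of a unital `*`-homomorphism to square matrices. -/
def matMap (φ : A →⋆ₐ[ℂ] B) (n : ℕ) :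
    Matrix (Fin n) (Fin n) A →⋆* Matrix (Fin n) (Fin n) B where
  toFun M := M.map φ
  map_one' := by simp [Matrix.map_one]
  map_mul' M N := Matrix.map_mul (f := φ)
  map_star' M := by ext i j; simp [Matrix.star_apply, map_star]

lemma isStarProjection_map (φ : A →⋆ₐ[ℂ] B) {n : ℕ} {p : Matrix (Fin n) (Fin n) A}
    (hp : IsStarProjection p) : IsStarProjection (p.map φ) :=
  hp.map (matMap φ n)

lemma MvN.map (φ : A →⋆ₐ[ℂ] B) {m n : ℕ} {p : Matrix (Fin m) (Fin m) A}
    {q : Matrix (Fin n) (Fin n) A} (h : MvN p q) : MvN (p.map φ) (q.map φ) := by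
  obtain ⟨v, rfl, rfl⟩ := h
  have e : (v.map φ)ᴴ = vᴴ.map φ := by ext i j; simp [map_star]
  exact ⟨v.map φ, by rw [e, Matrix.map_mul], by rw [e, Matrix.map_mul]⟩

/-- The map `V(A) → V(B)`, `[p] ↦ [φ(p)]`. -/
def V.map (φ : A →⋆ₐ[ℂ] B) : V A →+ V B where
  toFun := Quotient.map (fun p => ⟨p.1, p.2.1.map φ, isStarProjection_map φ p.2.2⟩)
    (fun _ _ h => MvN.map φ h)
  map_zero' := by
    change V.mk _ _ = V.mk _ _
    congr 1
    ext i j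
    exact i.elim0
  map_add' x y := by
    induction x using V.ind with | _ m p hp
    induction y using V.ind with | _ n q hq
    change V.mk ((dsum p q).map φ) (isStarProjection_map φ (isStarProjection_dsum hp hq)) =
      V.mk (dsum (p.map φ) (q.map φ)) _
    congr 1
    simp only [dsum, Matrix.reindex_apply, ← Matrix.submatrix_map, Matrix.fromBlocks_map,
      Matrix.map_zero _ (map_zero φ)]

end Projections

/-- `K₀(A)`: the Grothendieck group of `V(A)`, for a unital C⋆-algebra `A`. -/
abbrev K0 (A : Type*) [CStarAlgebra A] : Type _ := Algebra.GrothendieckAddGroup (V A)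

/-- The homomorphism `K₀(φ) : K₀(A) → K₀(B)`, `[p] - [q] ↦ [φ(p)] - [φ(q)]`. -/
def K0.map {A B : Type*} [CStarAlgebra A] [CStarAlgebra B] (φ : A →⋆ₐ[ℂ] B) : K0 A →+ K0 B :=
  Algebra.GrothendieckAddGroup.lift (Algebra.GrothendieckAddGroup.of.comp (V.map φ))

/-! ### Unitaries and `K₁` -/

section Unitaries

variable {A : Type*} [CStarAlgebra A]

variable (A) in
/-- The unitary group `U_n(A)` of `M_n(A)`. It carries the topology of entrywise norm convergence,
which is the topology of the C⋆-norm on `M_n(A)`. -/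
abbrev U (n : ℕ) : Type _ := unitary (Matrix (Fin n) (Fin n) A)

/-- The embedding `u ↦ diag(u, 1)` on matrices. -/
def extMat {n m : ℕ} (M : Matrix (Fin n) (Fin n) A) : Matrix (Fin m) (Fin m) A := fun i j =>
  if hi : i.1 < n then (if hj : j.1 < n then M ⟨i, hi⟩ ⟨j, hj⟩ else 0)
  else if i = j then 1 else 0

lemma extMat_eq_dsum {n k : ℕ} (M : Matrix (Fin n) (Fin n) A) :
    extMat (m := n + k) M = dsum M 1 := by
  ext i j
  refine Fin.addCases (fun i => ?_) (fun i => ?_) i <;>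
  refine Fin.addCases (fun j => ?_) (fun j => ?_) j <;>
  simp [extMat, dsum, Matrix.one_apply, Fin.ext_iff]
  intro h
  omega

lemma dsum_mul_dsum {m n : ℕ} (p p' : Matrix (Fin m) (Fin m) A) (q q' : Matrix (Fin n) (Fin n) A) :
    dsum p q * dsum p' q' = dsum (p * p') (q * q') := by
  simp only [dsum, Matrix.reindex_apply]
  rw [Matrix.submatrix_mul_equiv, Matrix.fromBlocks_multiply]
  simp

lemma star_dsum {m n : ℕ} (p : Matrix (Fin m) (Fin m) A) (q : Matrix (Fin n) (Fin n) A) :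
    star (dsum p q) = dsum (star p) (star q) := by
  simp only [dsum, Matrix.star_eq_conjTranspose, Matrix.conjTranspose_reindex,
    Matrix.fromBlocks_conjTranspose, Matrix.conjTranspose_zero]

lemma dsum_one_one {m n : ℕ} :
    dsum (1 : Matrix (Fin m) (Fin m) A) (1 : Matrix (Fin n) (Fin n) A) = 1 := by
  simp [dsum, Matrix.fromBlocks_one]

/-- The embedding `u ↦ diag(u, 1)` of `M_n(A)` into `M_m(A)`, for `n ≤ m`, as a homomorphism of
multiplicative monoids with involution. -/
def extHom {n m : ℕ} (h : n ≤ m) :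
    Matrix (Fin n) (Fin n) A →⋆* Matrix (Fin m) (Fin m) A where
  toFun := extMat
  map_one' := by
    obtain ⟨k, rfl⟩ := Nat.exists_eq_add_of_le h
    rw [extMat_eq_dsum, dsum_one_one]
  map_mul' M N := by
    obtain ⟨k, rfl⟩ := Nat.exists_eq_add_of_le h
    simp [extMat_eq_dsum, dsum_mul_dsum]
  map_star' M := by
    obtain ⟨k, rfl⟩ := Nat.exists_eq_add_of_le h
    simp [extMat_eq_dsum, star_dsum]

variable (A) in
/-- The embedding `U_n(A) → U_m(A)`, `u ↦ diag(u, 1)`, for `n ≤ m`. -/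
def stab (n m : ℕ) (h : n ≤ m) : U A n →* U A m := (Unitary.map (extHom h)).toMonoidHom

lemma coe_stab {n m : ℕ} (h : n ≤ m) (u : U A n) :
    (stab A n m h u : Matrix (Fin m) (Fin m) A) = extMat u.1 := rfl

lemma continuous_stab {n m : ℕ} (h : n ≤ m) : Continuous (stab A n m h) := by
  refine Continuous.subtype_mk ?_ _
  change Continuous fun u : U A n => (extMat u.1 : Matrix (Fin m) (Fin m) A)
  refine continuous_matrix fun i j => ?_
  simp only [extMat]
  split_ifs
  · exact continuous_subtype_val.matrix_elem _ _
  all_goals exact continuous_const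

instance : DirectedSystem (U A) (fun n m h => stab A n m h) where
  map_self n u := by
    apply Subtype.ext
    rw [coe_stab]
    ext i j
    simp [extMat]
  map_map k j i hij hjk u := by
    apply Subtype.ext
    simp only [coe_stab]
    ext a b
    simp only [extMat, Fin.ext_iff]
    split_ifs <;> first | rfl | omega

variable (A) in
/-- The group `U_∞(A) = ⋃ U_n(A)`, the direct limit along the embeddings `u ↦ diag(u, 1)`. -/
abbrev Uinf : Type _ := DirectLimit (U A) (stab A)

/-- The class in `U_∞(A)` of a unitary in `U_n(A)`. -/
def Uinf.mk {n : ℕ} (u : U A n) : Uinf A := ⟦⟨n, u⟩⟧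

lemma Uinf.mk_stab {n m : ℕ} (h : n ≤ m) (u : U A n) : Uinf.mk (stab A n m h u) = Uinf.mk u :=
  DirectLimit.mk_apply _ _ _ _

lemma Uinf.mk_mul {n : ℕ} (u v : U A n) : Uinf.mk u * Uinf.mk v = Uinf.mk (u * v) :=
  DirectLimit.mul_def _ _ _

lemma Uinf.mk_inv {n : ℕ} (u : U A n) : (Uinf.mk u)⁻¹ = Uinf.mk u⁻¹ := rfl

lemma Uinf.exists_mk (x : Uinf A) : ∃ (n : ℕ) (u : U A n), x = Uinf.mk u :=
  DirectLimit.exists_eq_mk _ x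

lemma Uinf.exists_mk₂ (x y : Uinf A) :
    ∃ (n : ℕ) (u v : U A n), x = Uinf.mk u ∧ y = Uinf.mk v :=
  DirectLimit.exists_eq_mk₂ _ x y

lemma joined_one_mul {n : ℕ} {u v : U A n} (hu : Joined 1 u) (hv : Joined 1 v) :
    Joined 1 (u * v) := by
  simpa using hu.mul hv

lemma joined_one_stab {n m : ℕ} (h : n ≤ m) {u : U A n} (hu : Joined 1 u) :
    Joined 1 (stab A n m h u) := by
  simpa using hu.map (continuous_stab h)

variable (A) in
/-- The subgroup `U_∞(A)₀` of those elements that are connected to `1` by a path in some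
`U_n(A)`. -/
def Uinf0 : Subgroup (Uinf A) where
  carrier := {x | ∃ (n : ℕ) (u : U A n), Joined 1 u ∧ Uinf.mk u = x}
  one_mem' := ⟨0, 1, Joined.refl _, (DirectLimit.one_def 0).symm⟩
  mul_mem' := by
    rintro _ _ ⟨n, u, hu, rfl⟩ ⟨m, v, hv, rfl⟩
    refine ⟨max n m, _, joined_one_mul (joined_one_stab (le_max_left n m) hu)
      (joined_one_stab (le_max_right n m) hv), ?_⟩
    rw [← Uinf.mk_mul, Uinf.mk_stab, Uinf.mk_stab]
  inv_mem' := by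
    rintro _ ⟨n, u, hu, rfl⟩
    exact ⟨n, u⁻¹, by simpa using hu.inv, (Uinf.mk_inv u).symm⟩

/-- The rotation matrix `((cos t, -sin t), (sin t, cos t))` with scalar blocks of size `n`. -/
def rot (n : ℕ) (t : ℝ) : Matrix (Fin (n + n)) (Fin (n + n)) A :=
  Matrix.reindex finSumFinEquiv finSumFinEquiv
    (Matrix.fromBlocks ((Real.cos t : ℂ) • 1) (-((Real.sin t : ℂ) • 1))
      ((Real.sin t : ℂ) • 1) ((Real.cos t : ℂ) • 1))

lemma star_rot (n : ℕ) (t : ℝ) : star (rot n t : Matrix _ _ A) = rot n (-t) := by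
  simp only [rot, Matrix.star_eq_conjTranspose, Matrix.conjTranspose_reindex,
    Matrix.fromBlocks_conjTranspose]
  simp [Matrix.conjTranspose_smul, -Complex.ofReal_cos, -Complex.ofReal_sin]

lemma rot_mul_rot (n : ℕ) (s t : ℝ) : (rot n s * rot n t : Matrix _ _ A) = rot n (s + t) := by
  simp only [rot, Matrix.reindex_apply]
  rw [Matrix.submatrix_mul_equiv, Matrix.fromBlocks_multiply]
  congr 2 <;>
  simp [Real.cos_add, Real.sin_add, smul_smul, add_smul, sub_smul, mul_comm] <;> abel

lemma rot_zero (n : ℕ) : (rot n 0 : Matrix _ _ A) = 1 := by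
  simp [rot, Matrix.fromBlocks_one]

variable (A) in
/-- The rotation as a unitary. -/
def rotU (n : ℕ) (t : ℝ) : U A (n + n) :=
  ⟨rot n t, Unitary.mem_iff.2 ⟨by simp [star_rot, rot_mul_rot, rot_zero],
    by simp [star_rot, rot_mul_rot, rot_zero]⟩⟩

lemma continuous_rotU (n : ℕ) : Continuous (rotU A n) := by
  refine Continuous.subtype_mk ?_ _
  refine Continuous.matrix_reindex ?_ _ _
  refine Continuous.matrix_fromBlocks ?_ ?_ ?_ ?_ <;> fun_prop

lemma rotU_zero (n : ℕ) : rotU A n 0 = 1 := Subtype.ext (rot_zero n)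

lemma rotU_conj (n : ℕ) (v : U A n) :
    (rotU A n (Real.pi / 2) * stab A n (n + n) (Nat.le_add_right n n) v *
      (rotU A n (Real.pi / 2))⁻¹).1 = dsum 1 v.1 := by
  change rot n (Real.pi / 2) * extMat v.1 * star (rot n (Real.pi / 2)) = _
  rw [star_rot, extMat_eq_dsum]
  simp only [rot, dsum, Matrix.reindex_apply]
  rw [Matrix.submatrix_mul_equiv, Matrix.submatrix_mul_equiv, Matrix.fromBlocks_multiply,
    Matrix.fromBlocks_multiply]
  simp

/-- Commutators in `U_n(A)` become homotopic to `1` in `U_{2n}(A)`. -/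
lemma joined_commutator (n : ℕ) (u v : U A n) :
    Joined 1 (stab A n (n + n) (Nat.le_add_right n n) (u * v * u⁻¹ * v⁻¹)) := by
  set S := stab A n (n + n) (Nat.le_add_right n n) with hS
  let w : ℝ → U A (n + n) := fun t =>
    S u * (rotU A n t * S v * (rotU A n t)⁻¹) * (S u)⁻¹ * (rotU A n t * S v * (rotU A n t)⁻¹)⁻¹
  have hw : Continuous w := by
    have := continuous_rotU (A := A) n
    fun_prop
  have h0 : w 0 = S (u * v * u⁻¹ * v⁻¹) := by simp [w, rotU_zero]
  have h1 : w (Real.pi / 2) = 1 := by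
    have hc : S u * (rotU A n (Real.pi / 2) * S v * (rotU A n (Real.pi / 2))⁻¹) =
        (rotU A n (Real.pi / 2) * S v * (rotU A n (Real.pi / 2))⁻¹) * S u := by
      apply Subtype.ext
      have e1 : (S u).1 = dsum u.1 1 := by rw [hS, coe_stab, extMat_eq_dsum]
      have e2 := rotU_conj n v
      rw [← hS] at e2
      rw [Submonoid.coe_mul (unitary _) (S u), Submonoid.coe_mul (unitary _) _ (S u), e1, e2,
        dsum_mul_dsum, dsum_mul_dsum]
      simp
    simp only [w]
    rw [hc]
    group
  have hj : Joined (w (Real.pi / 2)) (w 0) := by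
    have := (PathConnectedSpace.joined (Real.pi / 2) (0 : ℝ)).map hw
    exact this
  rwa [h0, h1] at hj

lemma commutator_mem (x y : Uinf A) : x * y * x⁻¹ * y⁻¹ ∈ Uinf0 A := by
  obtain ⟨n, u, v, rfl, rfl⟩ := Uinf.exists_mk₂ x y
  refine ⟨n + n, _, joined_commutator n u v, ?_⟩
  rw [Uinf.mk_stab]
  simp only [Uinf.mk_inv, Uinf.mk_mul]

instance : (Uinf0 A).Normal where
  conj_mem x hx g := by
    have h := (Uinf0 A).mul_mem (commutator_mem g x) hx
    simpa using h

instance : CommGroup (Uinf A ⧸ Uinf0 A) where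
  mul_comm := by
    rintro ⟨x⟩ ⟨y⟩
    change (QuotientGroup.mk (x * y) : Uinf A ⧸ Uinf0 A) = QuotientGroup.mk (y * x)
    rw [QuotientGroup.eq]
    have := commutator_mem y⁻¹ x⁻¹
    simpa [mul_assoc] using this

end Unitaries

/-- `K₁(A) = U_∞(A) / U_∞(A)₀`, written additively, for a unital C⋆-algebra `A`. -/
abbrev K1 (A : Type*) [CStarAlgebra A] : Type _ := Additive (Uinf A ⧸ Uinf0 A)

section Map

variable {A B : Type*} [CStarAlgebra A] [CStarAlgebra B]

/-- Entrywise application of a unital `*`-homomorphism, `U_n(A) → U_n(B)`. -/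
def uMap (φ : A →⋆ₐ[ℂ] B) (n : ℕ) : U A n →* U B n := (Unitary.map (matMap φ n)).toMonoidHom

lemma coe_uMap (φ : A →⋆ₐ[ℂ] B) {n : ℕ} (u : U A n) :
    (uMap φ n u : Matrix (Fin n) (Fin n) B) = u.1.map φ := rfl

lemma continuous_uMap (φ : A →⋆ₐ[ℂ] B) (n : ℕ) : Continuous (uMap φ n) := by
  refine Continuous.subtype_mk ?_ _
  change Continuous fun u : U A n => u.1.map φ
  exact continuous_subtype_val.matrix_map (map_continuous φ)

lemma uMap_stab (φ : A →⋆ₐ[ℂ] B) {n m : ℕ} (h : n ≤ m) (u : U A n) :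
    uMap φ m (stab A n m h u) = stab B n m h (uMap φ n u) := by
  apply Subtype.ext
  rw [coe_uMap, coe_stab, coe_stab, coe_uMap]
  ext i j
  simp only [extMat, Matrix.map_apply]
  split_ifs <;> simp

/-- The homomorphism `U_∞(A) → U_∞(B)` induced by a unital `*`-homomorphism. -/
def Uinf.map (φ : A →⋆ₐ[ℂ] B) : Uinf A →* Uinf B where
  toFun := DirectLimit.map (stab A) (stab B) (fun n u => uMap φ n u)
    (fun _ _ h u => (uMap_stab φ h u).symm)
  map_one' := by
    rw [DirectLimit.one_def 0, DirectLimit.one_def 0, DirectLimit.map_def]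
    simp
  map_mul' x y := by
    obtain ⟨n, u, v, rfl, rfl⟩ := Uinf.exists_mk₂ x y
    rw [Uinf.mk_mul]
    simp only [Uinf.mk, DirectLimit.map_def, map_mul]
    exact (DirectLimit.mul_def _ _ _).symm

lemma Uinf.map_mk (φ : A →⋆ₐ[ℂ] B) {n : ℕ} (u : U A n) :
    Uinf.map φ (Uinf.mk u) = Uinf.mk (uMap φ n u) := rfl

lemma Uinf0_le_comap (φ : A →⋆ₐ[ℂ] B) : Uinf0 A ≤ (Uinf0 B).comap (Uinf.map φ) := by
  rintro _ ⟨n, u, hu, rfl⟩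
  exact ⟨n, uMap φ n u, by simpa using hu.map (continuous_uMap φ n), (Uinf.map_mk φ u).symm⟩

/-- The homomorphism `K₁(φ) : K₁(A) → K₁(B)`, `[u] ↦ [φ(u)]`. -/
def K1.map (φ : A →⋆ₐ[ℂ] B) : K1 A →+ K1 B :=
  (QuotientGroup.map (Uinf0 A) (Uinf0 B) (Uinf.map φ) (Uinf0_le_comap φ)).toAdditive

end Map

end CStarK

/-! ### Circle actions -/

section Actions

variable {A : Type*} [CStarAlgebra A]

/-- The fixed point algebra `A^α`. -/
def fixedPointAlgebra (α : Circle →* (A ≃⋆ₐ[ℂ] A)) : StarSubalgebra ℂ A where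
  carrier := {a | ∀ ζ : Circle, α ζ a = a}
  mul_mem' ha hb ζ := by rw [map_mul, ha ζ, hb ζ]
  add_mem' ha hb ζ := by rw [map_add, ha ζ, hb ζ]
  algebraMap_mem' r ζ := by
    rw [Algebra.algebraMap_eq_smul_one, map_smul, map_one]
  star_mem' ha ζ := by rw [map_star, ha ζ]

instance fixedPointAlgebra.isClosed (α : Circle →* (A ≃⋆ₐ[ℂ] A)) :
    IsClosed (fixedPointAlgebra α : Set A) := by
  have : (fixedPointAlgebra α : Set A) = ⋂ ζ : Circle, {a | α ζ a = a} := by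
    ext a
    simp only [Set.mem_iInter, Set.mem_ofPred_eq]
    rfl
  rw [this]
  exact isClosed_iInter fun ζ =>
    isClosed_eq (NonUnitalStarAlgHom.isometry (α ζ) (α ζ).injective).continuous continuous_id

/-- The Rokhlin property of a circle action. -/
def HasRokhlinProperty (α : Circle →* (A ≃⋆ₐ[ℂ] A)) : Prop :=
  ∀ ε : ℝ, 0 < ε → ∀ F : Finset A, ∃ u ∈ unitary A,
    (∀ ζ : Circle, ‖α ζ u - (ζ : ℂ) • u‖ < ε) ∧ ∀ a ∈ F, ‖u * a - a * u‖ < ε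

end Actions

/-- A subgroup `H` of an abelian group `G` is pure if every torsion element of `G / H` lifts to a
torsion element of `G` of the same order. -/
def AddSubgroup.IsPure {G : Type*} [AddCommGroup G] (H : AddSubgroup G) : Prop :=
  ∀ x : G ⧸ H, IsOfFinAddOrder x →
    ∃ g : G, (QuotientAddGroup.mk g : G ⧸ H) = x ∧ IsOfFinAddOrder g ∧
      addOrderOf g = addOrderOf x

end

/-!
By averaging over the circle and taking polar parts, the Rokhlin unitaries may be chosen to satisfy
`α ζ u = ζ • u` exactly. On the spectral subspace of degree `n`, multiplication by `u ^ (-n)`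
then takes values in the fixed point algebra, and it is almost multiplicative since `u` is almost
central. These maps are not defined on all of `A`, but averaged compressions by `∑ k < N, (u⋆) ^ k`
are unital completely positive and approximate them as `N` grows, so they form an asymptotically
multiplicative net `ψ i : A → A ^ α` which converges pointwise to the identity on `A ^ α`.

Projections and unitaries over `A` can be transported along `ψ`, and any two ways of doing so
eventually agree in `K`-theory. This gives a homomorphism `Λ` from `K_j(A)` to the germs of nets in
`K_j(A ^ α)`, and `Λ ∘ K_j(ι)` sends `x` to the constant germ `x`. Evaluating `Λ` far along the net
turns a solution in `K_j(A)` of `k x = K_j(ι)(b)` into one of `k x' = b`, so `K_j(ι)` is a pure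
embedding, and a pure subgroup with finitely generated quotient is a direct summand.
-/

open Filter Topology

noncomputable section

/-! ### Pure embeddings of abelian groups -/

section Pure

variable {C C' D G H Q : Type*} [AddCommGroup C] [AddCommGroup C'] [AddCommGroup D]
  [AddCommGroup G] [AddCommGroup H] [AddCommGroup Q]

/-- A homomorphism `f : H → G` of abelian groups is a pure embedding if every equation `k x = b`
with `b ∈ H` that is solvable in `G` is already solvable in `H`. The case `k = 0` makes `f`
injective. -/
def IsPureEmbedding (f : H →+ G) : Prop :=
  ∀ (k : ℕ) (g : G) (b : H), k • g = f b → ∃ b', k • b' = b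

/-- Every homomorphism from `C` to `Q` lifts along `q : G → Q`. -/
def LiftsAlong (C : Type*) [AddCommGroup C] (q : G →+ Q) : Prop :=
  ∀ χ : C →+ Q, ∃ χ' : C →+ G, q.comp χ' = χ

namespace LiftsAlong

variable {q : G →+ Q}

lemma of_addEquiv (e : C ≃+ C') (h : LiftsAlong C q) : LiftsAlong C' q := by
  intro χ
  obtain ⟨χ', hχ'⟩ := h (χ.comp e.toAddMonoidHom)
  refine ⟨χ'.comp e.symm.toAddMonoidHom, ?_⟩
  ext c
  simpa using DFunLike.congr_fun hχ' (e.symm c)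

lemma prod (h : LiftsAlong C q) (h' : LiftsAlong C' q) : LiftsAlong (C × C') q := by
  intro χ
  obtain ⟨χ₁, h₁⟩ := h (χ.comp (AddMonoidHom.inl C C'))
  obtain ⟨χ₂, h₂⟩ := h' (χ.comp (AddMonoidHom.inr C C'))
  refine ⟨χ₁.coprod χ₂, ?_⟩
  rw [AddMonoidHom.comp_coprod, h₁, h₂, ← AddMonoidHom.comp_coprod, AddMonoidHom.coprod_inl_inr,
    AddMonoidHom.comp_id]

open DirectSum in
lemma directSum {ι : Type*} {C : ι → Type*} [∀ i, AddCommGroup (C i)]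
    (h : ∀ i, LiftsAlong (C i) q) : LiftsAlong (⨁ i, C i) q := by
  classical
  intro χ
  choose χ' hχ' using fun i => h i (χ.comp (of C i))
  refine ⟨toAddMonoid χ', addHom_ext fun i c => ?_⟩
  simpa using DFunLike.congr_fun (hχ' i) c

lemma of_projective [Module.Projective ℤ C] (hq : Function.Surjective q) : LiftsAlong C q := by
  intro χ
  obtain ⟨χ', hχ'⟩ :=
    Module.projective_lifting_property q.toIntLinearMap χ.toIntLinearMap hq
  exact ⟨χ'.toAddMonoidHom, AddMonoidHom.ext fun c => LinearMap.congr_fun hχ' c⟩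

lemma zmod {n : ℕ} (h : ∀ x : Q, n • x = 0 → ∃ g, q g = x ∧ n • g = 0) :
    LiftsAlong (ZMod n) q := by
  intro χ
  obtain ⟨g, hg, hg0⟩ := h (χ 1) (by rw [← map_nsmul]; simp)
  refine ⟨ZMod.lift n ⟨zmultiplesHom G g, by simpa using hg0⟩, ?_⟩
  ext c
  obtain ⟨z, rfl⟩ := ZMod.intCast_surjective c
  calc q (ZMod.lift n _ z) = z • q g := by rw [ZMod.lift_coe]; exact map_zsmul q z g
    _ = χ z := by rw [hg, ← map_zsmul, zsmul_one]

lemma of_fg [AddGroup.FG D] (hq : Function.Surjective q)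
    (htors : ∀ (n : ℕ) (x : Q), n • x = 0 → ∃ g, q g = x ∧ n • g = 0) : LiftsAlong D q := by
  obtain ⟨n, ι, _, p, _, e, ⟨E⟩⟩ := AddCommGroup.equiv_free_prod_directSum_zmod D
  exact ((of_projective hq).prod (directSum fun i => zmod (htors _))).of_addEquiv E.symm

end LiftsAlong

namespace IsPureEmbedding

variable {f : H →+ G}

lemma injective (hf : IsPureEmbedding f) : Function.Injective f := by
  refine (injective_iff_map_eq_zero f).2 fun b hb => ?_
  obtain ⟨b', hb'⟩ := hf 0 0 b (by rw [hb, smul_zero])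
  rw [← hb', zero_smul]

lemma exists_mk_eq_and_nsmul_eq_zero (hf : IsPureEmbedding f) (k : ℕ) (x : G ⧸ f.range)
    (hx : k • x = 0) : ∃ g, QuotientAddGroup.mk' f.range g = x ∧ k • g = 0 := by
  obtain ⟨g, rfl⟩ := QuotientAddGroup.mk'_surjective f.range x
  obtain ⟨b, hb⟩ : k • g ∈ f.range := (QuotientAddGroup.eq_zero_iff _).1 hx
  obtain ⟨b', rfl⟩ := hf k g b hb.symm
  have hb' : QuotientAddGroup.mk' f.range (f b') = 0 :=
    (QuotientAddGroup.eq_zero_iff _).2 ⟨b', rfl⟩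
  exact ⟨g - f b', by rw [map_sub, hb', sub_zero], by rw [smul_sub, ← map_nsmul, hb, sub_self]⟩

lemma isPure_range (hf : IsPureEmbedding f) : f.range.IsPure := by
  intro x hx
  obtain ⟨g, rfl, hg⟩ := hf.exists_mk_eq_and_nsmul_eq_zero _ x (addOrderOf_nsmul_eq_zero x)
  exact ⟨g, rfl, isOfFinAddOrder_iff_nsmul_eq_zero.2 ⟨_, hx.addOrderOf_pos, hg⟩,
    Nat.dvd_antisymm (addOrderOf_dvd_of_nsmul_eq_zero hg)
      (addOrderOf_map_dvd (QuotientAddGroup.mk' f.range) g)⟩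

lemma exists_retraction (hf : IsPureEmbedding f) [AddGroup.FG (G ⧸ f.range)] :
    ∃ π : G →+ H, π.comp f = AddMonoidHom.id H := by
  let q := QuotientAddGroup.mk' f.range
  have hq : Function.Surjective q := QuotientAddGroup.mk'_surjective _
  obtain ⟨s, hs⟩ := LiftsAlong.of_fg hq hf.exists_mk_eq_and_nsmul_eq_zero
    (AddMonoidHom.id (G ⧸ f.range))
  have hmem : ∀ g, g - s (q g) ∈ f.range := fun g => by
    refine (QuotientAddGroup.eq_zero_iff _).1 (?_ : q (g - s (q g)) = 0)
    rw [map_sub, sub_eq_zero]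
    exact (DFunLike.congr_fun hs (q g)).symm
  refine ⟨(AddMonoidHom.ofInjective hf.injective).symm.toAddMonoidHom.comp
    ((AddMonoidHom.id G - s.comp q).codRestrict f.range hmem), AddMonoidHom.ext fun b => ?_⟩
  have hb : q (f b) = 0 := (QuotientAddGroup.eq_zero_iff _).2 ⟨b, rfl⟩
  refine (AddMonoidHom.ofInjective hf.injective).symm_apply_eq.2 (Subtype.ext ?_)
  change f b - s (q (f b)) = f b
  rw [hb, map_zero, sub_zero]

end IsPureEmbedding

lemma isPureEmbedding_of_germ {ι : Type*} {l : Filter ι} [l.NeBot] {f : H →+ G}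
    (Λ : G →+ l.Germ H) (hΛ : ∀ b, Λ (f b) = (b : l.Germ H)) : IsPureEmbedding f := by
  intro k g b h
  obtain ⟨x, hx⟩ : ∃ x : ι → H, (x : l.Germ H) = Λ g := Quotient.exists_rep (Λ g)
  have hkx : ((k • x : ι → H) : l.Germ H) = (b : l.Germ H) := by
    rw [Germ.coe_smul, hx, ← map_nsmul, h, hΛ]
  obtain ⟨i, hi⟩ := (Germ.coe_eq.1 hkx).exists
  exact ⟨x i, hi⟩

end Pure

namespace CStarK

/-! ### Polar decomposition of invertible elements -/

section Polar

variable {M N : Type*} [CStarAlgebra M] [CStarAlgebra N] {x p q : M}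

attribute [local instance] CStarAlgebra.spectralOrder CStarAlgebra.spectralOrderedRing

/-- The unitary part `x |x|⁻¹` of the polar decomposition of an invertible element `x`. -/
def polar (x : M) : M := x * Ring.inverse (CFC.abs x)

lemma isUnit_cfcAbs (hx : IsUnit x) : IsUnit (CFC.abs x) :=
  (CFC.isUnit_sqrt_iff _ (star_mul_self_nonneg x)).2 (hx.star.mul hx)

lemma polar_mul_cfcAbs (hx : IsUnit x) : polar x * CFC.abs x = x := by
  rw [polar, mul_assoc, Ring.inverse_mul_cancel _ (isUnit_cfcAbs hx), mul_one]

lemma polar_mem_unitary (hx : IsUnit x) : polar x ∈ unitary M := by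
  have habs := isUnit_cfcAbs hx
  have hsa : IsSelfAdjoint (CFC.abs x) := .of_nonneg (CFC.abs_nonneg x)
  have hstar : star (polar x) * polar x = 1 := by
    refine habs.mul_left_cancel (habs.mul_right_cancel ?_)
    calc CFC.abs x * (star (polar x) * polar x) * CFC.abs x
        = star (polar x * CFC.abs x) * (polar x * CFC.abs x) := by
          rw [star_mul, hsa.star_eq]; simp only [mul_assoc]
      _ = CFC.abs x * 1 * CFC.abs x := by rw [polar_mul_cfcAbs hx, mul_one, CFC.abs_mul_abs]
  obtain ⟨y, hy⟩ : ∃ y, polar x * y = 1 := (hx.mul habs.ringInverse).exists_right_inv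
  exact Unitary.mem_iff.2 ⟨hstar, by rw [left_inv_eq_right_inv hstar hy, hy]⟩

lemma map_cfcAbs (φ : M ≃⋆ₐ[ℂ] N) (x : M) : φ (CFC.abs x) = CFC.abs (φ x) := by
  refine (CFC.sqrt_unique ?_ ?_).symm
  · rw [← map_mul, CFC.abs_mul_abs, map_mul, map_star]
  · exact map_nonneg φ (CFC.abs_nonneg x)

lemma map_polar (φ : M ≃⋆ₐ[ℂ] N) (hx : IsUnit x) : φ (polar x) = polar (φ x) := by
  refine (isUnit_cfcAbs (hx.map φ)).mul_right_cancel ?_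
  rw [polar_mul_cfcAbs (hx.map φ), ← map_cfcAbs, ← map_mul, polar_mul_cfcAbs hx]

lemma polar_smul {c : ℂ} (hc : ‖c‖ = 1) (x : M) : polar (c • x) = c • polar x := by
  rw [polar, CFC.abs_smul, hc, one_smul, smul_mul_assoc, polar]

lemma polar_mul_comm_of_intertwines (hx : IsUnit x) (h : x * q = p * x)
    (hq : Commute (star x * x) q) : polar x * q = p * polar x := by
  have habs : Commute (CFC.abs x) q := .cfcₙ_nnreal hq _
  refine (isUnit_cfcAbs hx).mul_right_cancel ?_
  rw [mul_assoc, ← habs.eq, ← mul_assoc, mul_assoc p, polar_mul_cfcAbs hx, h]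

lemma isSelfAdjoint_polar (hx : IsUnit x) (hsa : IsSelfAdjoint x) : IsSelfAdjoint (polar x) := by
  have habs := isUnit_cfcAbs hx
  have hcomm : polar x * CFC.abs x = CFC.abs x * polar x :=
    polar_mul_comm_of_intertwines hx (CFC.commute_abs_self x).eq.symm
      (by rw [← CFC.abs_mul_abs]; exact (Commute.refl _).mul_left (Commute.refl _))
  refine habs.mul_left_cancel ?_
  calc CFC.abs x * star (polar x) = star (polar x * CFC.abs x) := by
        rw [star_mul, (IsSelfAdjoint.of_nonneg (CFC.abs_nonneg x)).star_eq]
    _ = CFC.abs x * polar x := by rw [polar_mul_cfcAbs hx, hsa.star_eq, ← hcomm,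
        polar_mul_cfcAbs hx]

lemma isUnit_of_isUnit_star_mul_self (h : IsUnit (star x * x)) (h' : IsUnit (x * star x)) :
    IsUnit x := by
  obtain ⟨b, hb⟩ := h.exists_left_inv
  obtain ⟨c, hc⟩ := h'.exists_right_inv
  exact isUnit_iff_exists_and_exists.2
    ⟨⟨star x * c, by rw [← mul_assoc, hc]⟩, ⟨b * star x, by rw [mul_assoc, hb]⟩⟩

section Asymptotics

variable {ι : Type*} {l : Filter ι} {x : ι → M}

lemma eventually_isUnit_of_tendsto_one {y : ι → M} (hy : Tendsto y l (𝓝 1)) :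
    ∀ᶠ i in l, IsUnit (y i) :=
  hy.eventually (Units.isOpen.mem_nhds isUnit_one)

lemma eventually_isUnit (h : Tendsto (fun i => star (x i) * x i) l (𝓝 1))
    (h' : Tendsto (fun i => x i * star (x i)) l (𝓝 1)) : ∀ᶠ i in l, IsUnit (x i) := by
  filter_upwards [eventually_isUnit_of_tendsto_one h, eventually_isUnit_of_tendsto_one h']
    with i hi hi' using isUnit_of_isUnit_star_mul_self hi hi'

lemma tendsto_polar_sub (h : Tendsto (fun i => star (x i) * x i) l (𝓝 1))
    (h' : Tendsto (fun i => x i * star (x i)) l (𝓝 1)) :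
    Tendsto (fun i => polar (x i) - x i) l (𝓝 0) := by
  have habs : Tendsto (fun i => CFC.abs (x i)) l (𝓝 1) := by
    have hsqrt : ContinuousWithinAt CFC.sqrt {a : M | 0 ≤ a} 1 :=
      CFC.continuousOn_sqrt 1 (by simp)
    have := hsqrt.tendsto.comp (tendsto_nhdsWithin_iff.2
      ⟨h, Eventually.of_forall fun i => by simp⟩)
    rwa [CFC.sqrt_one] at this
  have hle : ∀ᶠ i in l, ‖polar (x i) - x i‖ ≤ ‖1 - CFC.abs (x i)‖ := by
    filter_upwards [eventually_isUnit h h'] with i hi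
    calc ‖polar (x i) - x i‖ = ‖polar (x i) * (1 - CFC.abs (x i))‖ := by
          rw [mul_sub, mul_one, polar_mul_cfcAbs hi]
      _ = ‖1 - CFC.abs (x i)‖ := CStarRing.norm_mem_unitary_mul _ (polar_mem_unitary hi)
      _ ≤ _ := le_rfl
  refine squeeze_zero_norm' hle ?_
  simpa using ((tendsto_const_nhds (x := (1 : M))).sub habs).norm

end Asymptotics

lemma exists_unitary_mul_eq_mul_of_norm_sub_lt_one (hp : IsStarProjection p)
    (hq : IsStarProjection q) (h : ‖p - q‖ < 1) : ∃ u ∈ unitary M, u * q = p * u := by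
  have hpp (y : M) : p * (p * y) = p * y := by rw [← mul_assoc, hp.isIdempotentElem.eq]
  have hqq (y : M) : q * (q * y) = q * y := by rw [← mul_assoc, hq.isIdempotentElem.eq]
  set x := p * q + (1 - p) * (1 - q) with hx
  have hxs : star x = q * p + (1 - q) * (1 - p) := by
    simp [hx, hp.isSelfAdjoint.star_eq, hq.isSelfAdjoint.star_eq]
  have hsq : IsUnit (1 - (p - q) * (p - q)) := by
    refine isUnit_one_sub_of_norm_lt_one ((norm_mul_le _ _).trans_lt ?_)
    nlinarith [norm_nonneg (p - q)]
  have h₁ : star x * x = 1 - (p - q) * (p - q) := by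
    rw [hxs, hx]
    simp only [mul_add, add_mul, mul_sub, sub_mul, one_mul, mul_one, mul_assoc, hpp,
      hp.isIdempotentElem.eq, hq.isIdempotentElem.eq]
    abel
  have h₂ : x * star x = 1 - (p - q) * (p - q) := by
    rw [hxs, hx]
    simp only [mul_add, add_mul, mul_sub, sub_mul, one_mul, mul_one, mul_assoc, hqq,
      hp.isIdempotentElem.eq, hq.isIdempotentElem.eq]
    abel
  have hxu : IsUnit x := isUnit_of_isUnit_star_mul_self (h₁ ▸ hsq) (h₂ ▸ hsq)
  refine ⟨polar x, polar_mem_unitary hxu, polar_mul_comm_of_intertwines hxu ?_ ?_⟩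
  · simp only [hx, mul_add, add_mul, mul_sub, sub_mul, one_mul, mul_one, mul_assoc, hpp,
      hp.isIdempotentElem.eq, hq.isIdempotentElem.eq]
    abel
  · rw [h₁]
    simp only [Commute, SemiconjBy, mul_sub, sub_mul, one_mul, mul_one, mul_assoc, hqq,
      hp.isIdempotentElem.eq, hq.isIdempotentElem.eq]
    abel

end Polar

/-! ### Asymptotic morphisms -/

section AsympMorphism

variable {A B ι : Type*} [CStarAlgebra A] [CStarAlgebra B]

/-- A net of bounded linear `*`-preserving maps `ψ i : A → B` is an asymptotic morphism along `l` if
it is asymptotically multiplicative and asymptotically unital. -/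
structure IsAsympMorphism (l : Filter ι) (ψ : ι → A →ₗ[ℂ] B) : Prop where
  map_star : ∀ i a, ψ i (star a) = star (ψ i a)
  exists_bound : ∃ C : ℝ, ∀ i a, ‖ψ i a‖ ≤ C * ‖a‖
  tendsto_mul : ∀ a b, Tendsto (fun i => ψ i (a * b) - ψ i a * ψ i b) l (𝓝 0)
  tendsto_one : Tendsto (fun i => ψ i 1) l (𝓝 1)

/-- An asymptotic morphism `ψ` from `A` to `B` is an asymptotic retraction of `φ : B → A` if
`ψ ∘ φ` converges pointwise to the identity of `B`. -/
structure IsAsympRetraction (l : Filter ι) (φ : B →⋆ₐ[ℂ] A) (ψ : ι → A →ₗ[ℂ] B) : Prop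
    extends IsAsympMorphism l ψ where
  tendsto_map : ∀ b, Tendsto (fun i => ψ i (φ b)) l (𝓝 b)

/-- The net `f` in `B` represents the image of `a ∈ A` under the asymptotic morphism `ψ`. -/
def IsAsympLift (l : Filter ι) (ψ : ι → A →ₗ[ℂ] B) (a : A) (f : ι → B) : Prop :=
  Tendsto (fun i => f i - ψ i a) l (𝓝 0)

variable {l : Filter ι} {ψ : ι → A →ₗ[ℂ] B} {a b : A} {f g : ι → B}

namespace IsAsympLift

lemma self (a : A) : IsAsympLift l ψ a fun i => ψ i a := by
  simpa only [IsAsympLift, sub_self] using tendsto_const_nhds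

lemma tendsto_sub (hf : IsAsympLift l ψ a f) (hg : IsAsympLift l ψ a g) :
    Tendsto (fun i => f i - g i) l (𝓝 0) := by
  simpa using Tendsto.sub hf hg

protected lemma zero : IsAsympLift l ψ 0 fun _ => 0 := by
  simpa [IsAsympLift] using tendsto_const_nhds

protected lemma add (hf : IsAsympLift l ψ a f) (hg : IsAsympLift l ψ b g) :
    IsAsympLift l ψ (a + b) fun i => f i + g i := by
  simpa [IsAsympLift, add_sub_add_comm] using Tendsto.add hf hg

protected lemma sub (hf : IsAsympLift l ψ a f) (hg : IsAsympLift l ψ b g) :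
    IsAsympLift l ψ (a - b) fun i => f i - g i := by
  simpa [IsAsympLift, sub_sub_sub_comm] using Tendsto.sub hf hg

protected lemma const_smul (c : ℂ) (hf : IsAsympLift l ψ a f) :
    IsAsympLift l ψ (c • a) fun i => c • f i := by
  simpa [IsAsympLift, smul_sub] using Tendsto.const_smul hf c

end IsAsympLift

lemma isStarProjection_half_one_add {s : B} (hs : s ∈ unitary B) (hsa : IsSelfAdjoint s) :
    IsStarProjection ((1 / 2 : ℂ) • (1 + s)) := by
  have hss : s * s = 1 := by simpa [hsa.star_eq] using Unitary.star_mul_self_of_mem hs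
  refine ⟨?_, ?_⟩
  · simp only [IsIdempotentElem, smul_mul_smul_comm, mul_add, add_mul, mul_one, one_mul, hss]
    module
  · simp [isSelfAdjoint_iff, hsa.star_eq]

namespace IsAsympMorphism

variable (H : IsAsympMorphism l ψ)
include H

lemma isAsympLift_one : IsAsympLift l ψ 1 fun _ => 1 := by
  simpa [IsAsympLift] using (tendsto_const_nhds (x := (1 : B))).sub H.tendsto_one

lemma tendsto_one_of_isAsympLift (hf : IsAsympLift l ψ 1 f) : Tendsto f l (𝓝 1) := by
  simpa using (hf.tendsto_sub H.isAsympLift_one).add_const 1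

lemma isAsympLift_star (hf : IsAsympLift l ψ a f) :
    IsAsympLift l ψ (star a) fun i => star (f i) := by
  simpa [IsAsympLift, H.map_star] using Tendsto.star hf

lemma isBoundedUnder_norm (hf : IsAsympLift l ψ a f) :
    l.IsBoundedUnder (· ≤ ·) (norm ∘ f) := by
  obtain ⟨C, hC⟩ := H.exists_bound
  refine isBoundedUnder_of_eventually_le (a := 1 + C * ‖a‖) ?_
  filter_upwards [(tendsto_zero_iff_norm_tendsto_zero.1 hf).eventually_lt_const one_pos] with i hi
  calc ‖f i‖ = ‖(f i - ψ i a) + ψ i a‖ := by rw [sub_add_cancel]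
    _ ≤ 1 + C * ‖a‖ := (norm_add_le _ _).trans (add_le_add hi.le (hC i a))

lemma isAsympLift_mul (hf : IsAsympLift l ψ a f) (hg : IsAsympLift l ψ b g) :
    IsAsympLift l ψ (a * b) fun i => f i * g i := by
  have h₁ : Tendsto (fun i => (f i - ψ i a) * g i) l (𝓝 0) :=
    Tendsto.zero_mul_isBoundedUnder_le hf (H.isBoundedUnder_norm hg)
  have h₂ : Tendsto (fun i => ψ i a * (g i - ψ i b)) l (𝓝 0) :=
    isBoundedUnder_le_mul_tendsto_zero (H.isBoundedUnder_norm (.self a)) hg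
  refine ((h₁.add h₂).sub (H.tendsto_mul a b)).congr' (.of_forall fun i => ?_) |>.trans (by simp)
  simp only [sub_mul, mul_sub]
  abel

lemma exists_unitary_isAsympLift {u : A} (hu : u ∈ unitary A) :
    ∃ f : ι → unitary B, IsAsympLift l ψ u (fun i => f i) ∧
      (IsSelfAdjoint u → ∀ i, IsSelfAdjoint (f i : B)) := by
  classical
  have hs := H.isAsympLift_star (.self u)
  have h₁ : Tendsto (fun i => star (ψ i u) * ψ i u) l (𝓝 1) := by
    refine H.tendsto_one_of_isAsympLift ?_
    simpa only [Unitary.star_mul_self_of_mem hu] using H.isAsympLift_mul hs (.self u)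
  have h₂ : Tendsto (fun i => ψ i u * star (ψ i u)) l (𝓝 1) := by
    refine H.tendsto_one_of_isAsympLift ?_
    simpa only [Unitary.mul_star_self_of_mem hu] using H.isAsympLift_mul (.self u) hs
  let f : ι → unitary B := fun i =>
    if h : IsUnit (ψ i u) then ⟨polar (ψ i u), polar_mem_unitary h⟩ else 1
  refine ⟨f, ?_, fun hsa i => ?_⟩
  · refine (tendsto_polar_sub h₁ h₂).congr' ?_
    filter_upwards [eventually_isUnit h₁ h₂] with i hi
    simp [f, hi]
  · by_cases h : IsUnit (ψ i u)
    · have hψ : IsSelfAdjoint (ψ i u) := by rw [isSelfAdjoint_iff, ← H.map_star, hsa.star_eq]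
      simpa [f, h] using isSelfAdjoint_polar h hψ
    · simp [f, h]

lemma exists_isStarProjection_isAsympLift {p : A} (hp : IsStarProjection p) :
    ∃ p' : ι → B, (∀ i, IsStarProjection (p' i)) ∧ IsAsympLift l ψ p p' := by
  have hsa : IsSelfAdjoint (2 * p - 1) := by
    simp [isSelfAdjoint_iff, hp.isSelfAdjoint.star_eq, two_mul]
  obtain ⟨s, hs, hs'⟩ := H.exists_unitary_isAsympLift hp.two_mul_sub_one_mem_unitary
  refine ⟨fun i => (1 / 2 : ℂ) • (1 + s i),
    fun i => isStarProjection_half_one_add (s i).2 (hs' hsa i), ?_⟩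
  have hp' : p = (1 / 2 : ℂ) • (1 + (2 * p - 1)) := by
    rw [two_mul]
    module
  rw [hp']
  exact (H.isAsympLift_one.add hs).const_smul _

lemma eventually_exists_unitary_mul_eq_mul {p q u : A} {p' q' : ι → B} (hu : u ∈ unitary A)
    (h : u * q = p * u) (hp' : ∀ i, IsStarProjection (p' i)) (hq' : ∀ i, IsStarProjection (q' i))
    (hp : IsAsympLift l ψ p p') (hq : IsAsympLift l ψ q q') :
    ∀ᶠ i in l, ∃ w ∈ unitary B, w * q' i = p' i * w := by
  obtain ⟨v, hv, -⟩ := H.exists_unitary_isAsympLift hu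
  have hconj : IsAsympLift l ψ p fun i => v i * q' i * star (v i : B) := by
    have := H.isAsympLift_mul (H.isAsympLift_mul hv hq) (H.isAsympLift_star hv)
    rwa [h, mul_assoc, Unitary.mul_star_self_of_mem hu, mul_one] at this
  have hnorm := tendsto_zero_iff_norm_tendsto_zero.1 (hp.tendsto_sub hconj)
  filter_upwards [hnorm.eventually_lt_const one_pos] with i hi
  have hproj : IsStarProjection (v i * q' i * star (v i : B)) :=
    (hq' i).map (Unitary.conjStarAlgAut ℂ B (v i))
  obtain ⟨w, hw, hwv⟩ := exists_unitary_mul_eq_mul_of_norm_sub_lt_one (hp' i) hproj hi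
  refine ⟨w * v i, mul_mem hw (v i).2, ?_⟩
  calc w * v i * q' i = w * (v i * q' i * star (v i : B)) * v i := by
        simp [mul_assoc]
    _ = p' i * (w * v i) := by rw [hwv, mul_assoc]

lemma exists_pos_eventually_joined : ∃ δ > 0, ∀ u v : unitary A, dist u v < δ →
    ∀ f g : ι → unitary B, IsAsympLift l ψ u (fun i => f i) → IsAsympLift l ψ v (fun i => g i) →
      ∀ᶠ i in l, Joined (f i) (g i) := by
  obtain ⟨C, hC⟩ := H.exists_bound
  refine ⟨1 / (|C| + 1), by positivity, fun u v huv f g hf hg => ?_⟩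
  have huv' : |C| * ‖(u : A) - v‖ < 1 := by
    have : ‖(u : A) - v‖ < 1 / (|C| + 1) := by
      simpa only [Subtype.dist_eq, dist_eq_norm] using huv
    rw [lt_div_iff₀ (by positivity)] at this
    nlinarith [norm_nonneg ((u : A) - v), abs_nonneg C]
  have hfg : IsAsympLift l ψ (v - u) fun i => g i - f i := hg.sub hf
  filter_upwards [(tendsto_zero_iff_norm_tendsto_zero.1 hfg).eventually_lt_const one_pos]
    with i hi
  refine Unitary.joined _ _ ?_
  calc ‖(g i - f i : B)‖ = ‖(g i - f i - ψ i (v - u)) + ψ i (v - u)‖ := by rw [sub_add_cancel]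
    _ ≤ ‖(g i - f i - ψ i (v - u) : B)‖ + |C| * ‖(u : A) - v‖ := by
        refine (norm_add_le _ _).trans (add_le_add_right ((hC i _).trans ?_) _)
        rw [norm_sub_rev]
        gcongr
        exact le_abs_self C
    _ < 2 := by linarith

lemma eventually_joined_one {u : unitary A} (hu : Joined 1 u) {f : ι → unitary B}
    (hf : IsAsympLift l ψ u fun i => f i) : ∀ᶠ i in l, Joined 1 (f i) := by
  obtain ⟨δ, hδ, hjoin⟩ := H.exists_pos_eventually_joined
  let S : Set (unitary A) :=
    {v | ∀ g : ι → unitary B, IsAsympLift l ψ v (fun i => g i) → ∀ᶠ i in l, Joined 1 (g i)}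
  have hone : 1 ∈ S := fun g hg =>
    hjoin 1 1 (by simpa using hδ) (fun _ => 1) g H.isAsympLift_one hg
  have hnear : ∀ v ∈ S, ∀ w, dist v w < δ → w ∈ S := fun v hv w hvw g hg => by
    obtain ⟨f, hf, -⟩ := H.exists_unitary_isAsympLift v.2
    filter_upwards [hv f hf, hjoin v w hvw f g hf hg] with i h₁ h₂ using h₁.trans h₂
  have hopen : IsOpen S := Metric.isOpen_iff.2 fun v hv =>
    ⟨δ, hδ, fun w hw => hnear v hv w (Metric.mem_ball'.1 hw)⟩
  have hclosed : IsClosed S := ⟨Metric.isOpen_iff.2 fun v hv =>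
    ⟨δ, hδ, fun w hw hwS => hv (hnear w hwS v (Metric.mem_ball.1 hw))⟩⟩
  exact (IsClopen.connectedComponent_subset ⟨hclosed, hopen⟩ hone)
    (pathComponent_subset_component 1 hu) f hf

end IsAsympMorphism

lemma IsAsympRetraction.isAsympLift_map {φ : B →⋆ₐ[ℂ] A} (H : IsAsympRetraction l φ ψ) (b : B) :
    IsAsympLift l ψ (φ b) fun _ => b := by
  simpa [IsAsympLift] using (tendsto_const_nhds (x := b)).sub (H.tendsto_map b)

end AsympMorphism

/-! ### Matrices over asymptotic morphisms -/

section Matrices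

attribute [local instance] CStarAlgebra.spectralOrder CStarAlgebra.spectralOrderedRing

variable {A B ι : Type*} [CStarAlgebra A] [CStarAlgebra B] {l : Filter ι} {ψ : ι → A →ₗ[ℂ] B}
  {k m n : Type*}

/-- The net `Y` of matrices over `B` represents, entry by entry, the image of the matrix `X` under
the asymptotic morphism `ψ`. -/
def IsMatrixLift (l : Filter ι) (ψ : ι → A →ₗ[ℂ] B) (X : Matrix m n A) (Y : ι → Matrix m n B) :
    Prop :=
  ∀ r c, IsAsympLift l ψ (X r c) fun i => Y i r c

namespace IsMatrixLift

protected lemma zero : IsMatrixLift l ψ (0 : Matrix m n A) fun _ => 0 :=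
  fun _ _ => .zero

lemma fromBlocks {p : Matrix m m A} {q : Matrix n n A} {p' : ι → Matrix m m B}
    {q' : ι → Matrix n n B} (hp : IsMatrixLift l ψ p p') (hq : IsMatrixLift l ψ q q') :
    IsMatrixLift l ψ (Matrix.fromBlocks p 0 0 q) fun i => Matrix.fromBlocks (p' i) 0 0 (q' i)
  | .inl r, .inl c => hp r c
  | .inl _, .inr _ => .zero
  | .inr _, .inl _ => .zero
  | .inr r, .inr c => hq r c

lemma dsum {m n : ℕ} {p : Matrix (Fin m) (Fin m) A} {q : Matrix (Fin n) (Fin n) A}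
    {p' : ι → Matrix (Fin m) (Fin m) B} {q' : ι → Matrix (Fin n) (Fin n) B}
    (hp : IsMatrixLift l ψ p p') (hq : IsMatrixLift l ψ q q') :
    IsMatrixLift l ψ (CStarK.dsum p q) fun i => CStarK.dsum (p' i) (q' i) :=
  fun r c => hp.fromBlocks hq (finSumFinEquiv.symm r) (finSumFinEquiv.symm c)

end IsMatrixLift

lemma tendsto_cstarMatrix_iff {f : ι → CStarMatrix m n A} {X : CStarMatrix m n A} :
    Tendsto f l (𝓝 X) ↔ ∀ r c, Tendsto (fun i => f i r c) l (𝓝 (X r c)) :=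
  tendsto_pi_nhds.trans (forall_congr' fun _ => tendsto_pi_nhds)

section Square

variable [Fintype n]

lemma isAsympLift_mapₗ_iff [DecidableEq n] {X : CStarMatrix n n A} {Y : ι → CStarMatrix n n B} :
    IsAsympLift l (fun i => CStarMatrix.mapₗ (m := n) (n := n) (ψ i)) X Y ↔
      IsMatrixLift l ψ (CStarMatrix.ofMatrix.symm X) fun i => CStarMatrix.ofMatrix.symm (Y i) :=
  tendsto_cstarMatrix_iff

variable (A n) in
lemma exists_norm_le_mul_of_norm_entry_le :
    ∃ K : ℝ, ∀ (X : CStarMatrix n n A) (C : ℝ), 0 ≤ C → (∀ r c, ‖X r c‖ ≤ C) → ‖X‖ ≤ K * C := by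
  let L : (n → n → A) →L[ℂ] CStarMatrix n n A :=
    ⟨⟨⟨CStarMatrix.ofMatrix, fun _ _ => rfl⟩, fun _ _ => rfl⟩, continuous_id⟩
  refine ⟨‖L‖, fun X C hC hX => (L.le_opNorm X).trans ?_⟩
  gcongr
  exact (pi_norm_le_iff_of_nonneg hC).2 fun r => (pi_norm_le_iff_of_nonneg hC).2 (hX r)

lemma IsAsympMorphism.mapₗ [DecidableEq n] (H : IsAsympMorphism l ψ) :
    IsAsympMorphism l fun i => CStarMatrix.mapₗ (m := n) (n := n) (ψ i) where
  map_star i X := by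
    ext r c
    simp [CStarMatrix.star_apply, H.map_star]
  exists_bound := by
    obtain ⟨C, hC⟩ := H.exists_bound
    obtain ⟨K, hK⟩ := exists_norm_le_mul_of_norm_entry_le B n
    refine ⟨K * |C|, fun i X => ?_⟩
    rw [mul_assoc]
    refine hK _ _ (by positivity) fun r c => (hC i (X r c)).trans ?_
    gcongr
    exacts [le_abs_self C, CStarMatrix.norm_entry_le_norm]
  tendsto_mul X Y := tendsto_cstarMatrix_iff.2 fun r c => by
    have h := tendsto_finsetSum (Finset.univ : Finset n) fun d _ => H.tendsto_mul (X r d) (Y d c)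
    simpa [CStarMatrix.mul_apply, Finset.sum_sub_distrib] using h
  tendsto_one := tendsto_cstarMatrix_iff.2 fun r c => by
    by_cases h : r = c
    · simpa [CStarMatrix.one_apply, h] using H.tendsto_one
    · simpa [CStarMatrix.one_apply, h] using tendsto_const_nhds

lemma IsAsympMorphism.exists_isStarProjection_isMatrixLift (H : IsAsympMorphism l ψ)
    {p : Matrix n n A} (hp : IsStarProjection p) :
    ∃ p' : ι → Matrix n n B, (∀ i, IsStarProjection (p' i)) ∧ IsMatrixLift l ψ p p' := by
  classical
  obtain ⟨p', hp', h⟩ := (H.mapₗ (n := n)).exists_isStarProjection_isAsympLift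
    (p := CStarMatrix.ofMatrix p) ⟨hp.1, hp.2⟩
  exact ⟨p', fun i => ⟨(hp' i).1, (hp' i).2⟩, isAsympLift_mapₗ_iff.1 h⟩

end Square

/-! ### Lifting Murray–von Neumann equivalences -/

section MvN

variable [Fintype m] [Fintype n]

lemma MvN.exists_mul_eq {p : Matrix m m A} {q : Matrix n n A} (hp : IsStarProjection p)
    (hq : IsStarProjection q) (h : MvN p q) :
    ∃ v : Matrix m n A, v * vᴴ = p ∧ vᴴ * v = q ∧ p * v = v ∧ v * q = v := by
  obtain ⟨v, hv, hv'⟩ := h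
  have hpp : p * p = p := hp.isIdempotentElem
  have hqq : q * q = q := hq.isIdempotentElem
  have hps : pᴴ = p := hp.isSelfAdjoint
  have hqs : qᴴ = q := hq.isSelfAdjoint
  have hpv : p * v = v * q := by rw [← hv, ← hv', Matrix.mul_assoc]
  refine ⟨p * v, ?_, ?_, ?_, ?_⟩
  · rw [Matrix.conjTranspose_mul, hps, Matrix.mul_assoc, ← Matrix.mul_assoc v, hv, hpp, hpp]
  · rw [hpv, Matrix.conjTranspose_mul, hqs, Matrix.mul_assoc, ← Matrix.mul_assoc vᴴ, hv', hqq, hqq]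
  · rw [← Matrix.mul_assoc, hpp]
  · rw [hpv, Matrix.mul_assoc, hqq]

lemma MvN.exists_unitary_mul_fromBlocks_eq [DecidableEq m] [DecidableEq n] {p : Matrix m m A}
    {q : Matrix n n A} (hp : IsStarProjection p) (hq : IsStarProjection q) (h : MvN p q) :
    ∃ w ∈ unitary (Matrix (m ⊕ n) (m ⊕ n) A),
      w * Matrix.fromBlocks 0 0 0 q = Matrix.fromBlocks p 0 0 0 * w := by
  obtain ⟨v, hv, hv', hpv, hvq⟩ := h.exists_mul_eq hp hq
  have hpp : p * p = p := hp.isIdempotentElem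
  have hqq : q * q = q := hq.isIdempotentElem
  have hps : pᴴ = p := hp.isSelfAdjoint
  have hqs : qᴴ = q := hq.isSelfAdjoint
  have hvp : vᴴ * p = vᴴ := by rw [← hps, ← Matrix.conjTranspose_mul, hpv]
  have hqv : q * vᴴ = vᴴ := by rw [← hqs, ← Matrix.conjTranspose_mul, hvq]
  let w := Matrix.fromBlocks (1 - p) v vᴴ (1 - q)
  have hw : star w = w := by
    simp [w, Matrix.star_eq_conjTranspose, Matrix.fromBlocks_conjTranspose, hps, hqs]
  have hww : w * w = 1 := by
    simp [w, Matrix.fromBlocks_multiply, sub_mul, mul_sub, Matrix.sub_mul, Matrix.mul_sub,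
      hpp, hqq, hv, hv', hpv, hvq, hvp, hqv, ← Matrix.fromBlocks_one]
  refine ⟨w, Unitary.mem_iff.2 ⟨by rw [hw, hww], by rw [hw, hww]⟩, ?_⟩
  simp [w, Matrix.fromBlocks_multiply, sub_mul, mul_sub, hpp, hqq, hpv, hvq]

lemma MvN.of_unitary_mul_fromBlocks_eq [DecidableEq m] [DecidableEq n] {p : Matrix m m A}
    {q : Matrix n n A} (hp : IsStarProjection p) (hq : IsStarProjection q)
    {w : Matrix (m ⊕ n) (m ⊕ n) A}
    (hw : w ∈ unitary (Matrix (m ⊕ n) (m ⊕ n) A))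
    (h : w * Matrix.fromBlocks 0 0 0 q = Matrix.fromBlocks p 0 0 0 * w) : MvN p q := by
  obtain ⟨a, b, c, d, rfl⟩ : ∃ a b c d, w = Matrix.fromBlocks a b c d :=
    ⟨_, _, _, _, (Matrix.fromBlocks_toBlocks w).symm⟩
  have hqs : qᴴ = q := hq.isSelfAdjoint
  have hps : pᴴ = p := hp.isSelfAdjoint
  have hpp : p * p = p := hp.isIdempotentElem
  have hqq : q * q = q := hq.isIdempotentElem
  obtain ⟨hpa, hbq, -, hdq⟩ : 0 = p * a ∧ b * q = p * b ∧ True ∧ d * q = 0 := by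
    simpa [Matrix.fromBlocks_multiply, Matrix.fromBlocks_inj] using h
  have hrow : a * aᴴ + b * bᴴ = 1 := by
    have := Unitary.mul_star_self_of_mem hw
    rw [Matrix.star_eq_conjTranspose, Matrix.fromBlocks_conjTranspose, Matrix.fromBlocks_multiply,
      ← Matrix.fromBlocks_one, Matrix.fromBlocks_inj] at this
    exact this.1
  have hcol : bᴴ * b + dᴴ * d = 1 := by
    have := Unitary.star_mul_self_of_mem hw
    rw [Matrix.star_eq_conjTranspose, Matrix.fromBlocks_conjTranspose, Matrix.fromBlocks_multiply,
      ← Matrix.fromBlocks_one, Matrix.fromBlocks_inj] at this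
    exact this.2.2.2
  refine ⟨b * q, ?_, ?_⟩
  · calc b * q * (b * q)ᴴ = p * (b * bᴴ) * p := by
          rw [hbq, Matrix.conjTranspose_mul, hps]
          simp only [Matrix.mul_assoc]
      _ = p * (a * aᴴ + b * bᴴ) * p := by
          rw [mul_add, ← Matrix.mul_assoc p a, ← hpa, Matrix.zero_mul, zero_add]
      _ = p := by rw [hrow, mul_one, hpp]
  · calc (b * q)ᴴ * (b * q) = q * (bᴴ * b) * q := by
          rw [Matrix.conjTranspose_mul, hqs]
          simp only [Matrix.mul_assoc]
      _ = q * (bᴴ * b + dᴴ * d) * q := by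
          rw [mul_add, add_mul, Matrix.mul_assoc q (dᴴ * d), Matrix.mul_assoc dᴴ, hdq,
            Matrix.mul_zero, Matrix.mul_zero, add_zero]
      _ = q := by rw [hcol, mul_one, hqq]

lemma IsAsympMorphism.eventually_mvn (H : IsAsympMorphism l ψ) {p : Matrix m m A}
    {q : Matrix n n A} (hp : IsStarProjection p) (hq : IsStarProjection q) (h : MvN p q)
    {p' : ι → Matrix m m B} {q' : ι → Matrix n n B} (hp' : ∀ i, IsStarProjection (p' i))
    (hq' : ∀ i, IsStarProjection (q' i)) (hpl : IsMatrixLift l ψ p p')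
    (hql : IsMatrixLift l ψ q q') : ∀ᶠ i in l, MvN (p' i) (q' i) := by
  classical
  obtain ⟨w, hw, hwq⟩ := h.exists_unitary_mul_fromBlocks_eq hp hq
  have hp₀ := fun i => isStarProjection_blocks (hp' i) (.zero (Matrix n n B))
  have hq₀ := fun i => isStarProjection_blocks (.zero (Matrix m m B)) (hq' i)
  have ev := (H.mapₗ (n := m ⊕ n)).eventually_exists_unitary_mul_eq_mul
    (u := CStarMatrix.ofMatrix w) (p := CStarMatrix.ofMatrix (.fromBlocks p 0 0 0))
    (q := CStarMatrix.ofMatrix (.fromBlocks 0 0 0 q))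
    (p' := fun i => CStarMatrix.ofMatrix (.fromBlocks (p' i) 0 0 0))
    (q' := fun i => CStarMatrix.ofMatrix (.fromBlocks 0 0 0 (q' i)))
    hw hwq (fun i => ⟨(hp₀ i).1, (hp₀ i).2⟩) (fun i => ⟨(hq₀ i).1, (hq₀ i).2⟩)
    (isAsympLift_mapₗ_iff.2 (hpl.fromBlocks .zero)) (isAsympLift_mapₗ_iff.2 (.fromBlocks .zero hql))
  filter_upwards [ev] with i ⟨w', hw', hwq'⟩
  exact .of_unitary_mul_fromBlocks_eq (hp' i) (hq' i) hw' hwq'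

end MvN

/-! ### Lifting unitary matrices -/

section UnitaryMatrices

/-- The unitary group of `M_n(A)`, with entrywise convergence, is that of the C⋆-algebra of
matrices. -/
def unitaryCStarMatrix (A : Type*) [CStarAlgebra A] (n : ℕ) :
    U A n ≃ₜ* unitary (CStarMatrix (Fin n) (Fin n) A) where
  toFun u := ⟨CStarMatrix.ofMatrix u.1, u.2⟩
  invFun u := ⟨CStarMatrix.ofMatrix.symm u.1, u.2⟩
  left_inv _ := rfl
  right_inv _ := rfl
  map_mul' _ _ := rfl
  continuous_toFun := continuous_id
  continuous_invFun := continuous_id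

variable {n N : ℕ}

lemma IsMatrixLift.stab {u : U A n} {f : ι → U B n}
    (H : IsAsympMorphism l ψ) (hf : IsMatrixLift l ψ u.1 fun i => (f i).1) (h : n ≤ N) :
    IsMatrixLift l ψ (CStarK.stab A n N h u).1 fun i => (CStarK.stab B n N h (f i)).1 := by
  intro r c
  simp only [coe_stab, extMat]
  split_ifs
  exacts [hf _ _, .zero, H.isAsympLift_one, .zero]

namespace IsAsympMorphism

variable (H : IsAsympMorphism l ψ)
include H

lemma exists_unitary_isMatrixLift (u : U A n) :
    ∃ f : ι → U B n, IsMatrixLift l ψ u.1 fun i => (f i).1 := by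
  obtain ⟨f, hf, -⟩ := H.mapₗ.exists_unitary_isAsympLift (unitaryCStarMatrix A n u).2
  exact ⟨fun i => (unitaryCStarMatrix B n).symm (f i), isAsympLift_mapₗ_iff.1 hf⟩

lemma isMatrixLift_mul {u v : U A n} {f g : ι → U B n}
    (hf : IsMatrixLift l ψ u.1 fun i => (f i).1) (hg : IsMatrixLift l ψ v.1 fun i => (g i).1) :
    IsMatrixLift l ψ (u * v).1 fun i => (f i * g i).1 :=
  isAsympLift_mapₗ_iff.1 <|
    H.mapₗ.isAsympLift_mul (isAsympLift_mapₗ_iff.2 hf) (isAsympLift_mapₗ_iff.2 hg)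

lemma isMatrixLift_inv {u : U A n} {f : ι → U B n}
    (hf : IsMatrixLift l ψ u.1 fun i => (f i).1) :
    IsMatrixLift l ψ (u⁻¹).1 fun i => ((f i)⁻¹).1 :=
  isAsympLift_mapₗ_iff.1 <| H.mapₗ.isAsympLift_star (isAsympLift_mapₗ_iff.2 hf)

lemma eventually_joined_one_of_isMatrixLift {u : U A n} (hu : Joined 1 u) {f : ι → U B n}
    (hf : IsMatrixLift l ψ u.1 fun i => (f i).1) : ∀ᶠ i in l, Joined 1 (f i) := by
  have hj : Joined 1 (unitaryCStarMatrix A n u) := by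
    simpa using hu.map (map_continuous (unitaryCStarMatrix A n))
  filter_upwards [H.mapₗ.eventually_joined_one hj (f := fun i => unitaryCStarMatrix B n (f i))
    (isAsympLift_mapₗ_iff.2 hf)] with i hi
  simpa using hi.map (map_continuous (unitaryCStarMatrix B n).symm)

end IsAsympMorphism

end UnitaryMatrices

end Matrices

/-! ### `K`-theory of asymptotic morphisms -/

section Germs

variable {ι M N : Type*} {l : Filter ι}

lemma exists_addMonoidHom_germ [AddZeroClass M] [AddZeroClass N] {R : M → (ι → N) → Prop}
    (hex : ∀ x, ∃ f, R x f) (huniq : ∀ x f g, R x f → R x g → f =ᶠ[l] g)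
    (hzero : R 0 0) (hadd : ∀ x y f g, R x f → R y g → R (x + y) (f + g)) :
    ∃ Λ : M →+ l.Germ N, ∀ x f, R x f → Λ x = f := by
  choose F hF using hex
  refine ⟨⟨⟨fun x => F x, ?_⟩, fun x y => ?_⟩, fun x f hf => Germ.coe_eq.2 (huniq x _ _ (hF x) hf)⟩
  · exact Germ.coe_eq.2 (huniq _ _ _ (hF 0) hzero)
  · exact Germ.coe_eq.2 (huniq _ _ _ (hF _) (hadd _ _ _ _ (hF x) (hF y)))

end Germs

section Lifts

variable {A B ι : Type*} [CStarAlgebra A] [CStarAlgebra B] {l : Filter ι} {φ : B →⋆ₐ[ℂ] A}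
  {ψ : ι → A →ₗ[ℂ] B} {n N : ℕ}

/-- The class in `K₀(A)` of a projection in `M_n(A)`. -/
def K0.mk (p : Matrix (Fin n) (Fin n) A) (hp : IsStarProjection p) : K0 A :=
  Algebra.GrothendieckAddGroup.of (V.mk p hp)

lemma K0.map_of (φ : B →⋆ₐ[ℂ] A) (x : V B) :
    K0.map φ (Algebra.GrothendieckAddGroup.of x) = Algebra.GrothendieckAddGroup.of (V.map φ x) :=
  DFunLike.congr_fun (Algebra.GrothendieckAddGroup.lift.symm_apply_apply
    (Algebra.GrothendieckAddGroup.of.comp (V.map φ))) x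

/-- The net `f` in `K₀(B)` consists of the classes of projections which represent the image under
`ψ` of a projection of class `x`. -/
def IsK0Lift (l : Filter ι) (ψ : ι → A →ₗ[ℂ] B) (x : V A) (f : ι → K0 B) : Prop :=
  ∃ (n : ℕ) (p : Matrix (Fin n) (Fin n) A) (hp : IsStarProjection p)
    (p' : ι → Matrix (Fin n) (Fin n) B) (hp' : ∀ i, IsStarProjection (p' i)),
    V.mk p hp = x ∧ (fun i => K0.mk (p' i) (hp' i)) = f ∧ IsMatrixLift l ψ p p'

lemma IsK0Lift.add {x y : V A} {f g : ι → K0 B} (hx : IsK0Lift l ψ x f) (hy : IsK0Lift l ψ y g) :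
    IsK0Lift l ψ (x + y) (f + g) := by
  obtain ⟨m, p, hp, p', hp', rfl, rfl, hpl⟩ := hx
  obtain ⟨n, q, hq, q', hq', rfl, rfl, hql⟩ := hy
  exact ⟨m + n, dsum p q, isStarProjection_dsum hp hq, fun i => dsum (p' i) (q' i),
    fun i => isStarProjection_dsum (hp' i) (hq' i), rfl,
    funext fun i => map_add Algebra.GrothendieckAddGroup.of (V.mk (p' i) _) (V.mk (q' i) _),
    hpl.dsum hql⟩

namespace IsAsympMorphism

variable (H : IsAsympMorphism l ψ)
include H

lemma exists_isK0Lift (x : V A) : ∃ f, IsK0Lift l ψ x f := by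
  induction x using V.ind with | _ n p hp
  obtain ⟨p', hp', h⟩ := H.exists_isStarProjection_isMatrixLift hp
  exact ⟨_, n, p, hp, p', hp', rfl, rfl, h⟩

lemma eventuallyEq_of_isK0Lift {x : V A} {f g : ι → K0 B} (hf : IsK0Lift l ψ x f)
    (hg : IsK0Lift l ψ x g) : f =ᶠ[l] g := by
  obtain ⟨m, p, hp, p', hp', rfl, rfl, hpl⟩ := hf
  obtain ⟨n, q, hq, q', hq', hpq, rfl, hql⟩ := hg
  filter_upwards [H.eventually_mvn hp hq (V.mk_eq_mk.1 hpq.symm) hp' hq' hpl hql] with i hi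
  exact congrArg _ (V.mk_eq_mk.2 hi)

lemma exists_K0_germ : ∃ Λ : K0 A →+ l.Germ (K0 B),
    ∀ x f, IsK0Lift l ψ x f → Λ (Algebra.GrothendieckAddGroup.of x) = f := by
  obtain ⟨Λ, hΛ⟩ := exists_addMonoidHom_germ H.exists_isK0Lift
    (fun _ _ _ => H.eventuallyEq_of_isK0Lift)
    ⟨0, 0, .zero _, fun _ => 0, fun _ => .zero _, rfl,
      funext fun _ => map_zero Algebra.GrothendieckAddGroup.of, .zero⟩ fun _ _ _ _ => .add
  refine ⟨Algebra.GrothendieckAddGroup.lift Λ, fun x f hf => (?_ : _ = Λ x).trans (hΛ x f hf)⟩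
  exact DFunLike.congr_fun (Algebra.GrothendieckAddGroup.lift.symm_apply_apply Λ) x

end IsAsympMorphism

lemma IsAsympRetraction.isK0Lift_map (H : IsAsympRetraction l φ ψ) (x : V B) :
    IsK0Lift l ψ (V.map φ x) fun _ => Algebra.GrothendieckAddGroup.of x := by
  induction x using V.ind with | _ n p hp
  exact ⟨n, p.map φ, isStarProjection_map φ hp, fun _ => p, fun _ => hp, rfl, rfl,
    fun r c => H.isAsympLift_map (p r c)⟩

theorem IsAsympRetraction.isPureEmbedding_K0 [l.NeBot] (H : IsAsympRetraction l φ ψ) :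
    IsPureEmbedding (K0.map φ) := by
  obtain ⟨Λ, hΛ⟩ := H.exists_K0_germ
  let c : K0 B →+ l.Germ (K0 B) := ⟨⟨fun b => (b : l.Germ (K0 B)), rfl⟩, fun _ _ => rfl⟩
  have h : Λ.comp (K0.map φ) = c := by
    refine Algebra.GrothendieckAddGroup.lift.symm.injective (AddMonoidHom.ext fun x => ?_)
    change Λ (K0.map φ (Algebra.GrothendieckAddGroup.of x)) = _
    rw [K0.map_of]
    exact hΛ _ _ (H.isK0Lift_map x)
  exact isPureEmbedding_of_germ Λ (DFunLike.congr_fun h)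

/-- The class in `K₁(A)` of a unitary in `M_n(A)`. -/
def K1.mk (u : U A n) : K1 A := Additive.ofMul (Uinf.mk u : Uinf A ⧸ Uinf0 A)

namespace K1

lemma exists_mk (x : K1 A) : ∃ (n : ℕ) (u : U A n), mk u = x := by
  obtain ⟨y, hy⟩ := QuotientGroup.mk_surjective (Additive.toMul x)
  obtain ⟨n, u, rfl⟩ := Uinf.exists_mk y
  exact ⟨n, u, hy⟩

lemma mk_stab (h : n ≤ N) (u : U A n) : mk (stab A n N h u) = mk u := by
  rw [mk, mk, Uinf.mk_stab]

lemma mk_mul (u v : U A n) : mk (u * v) = mk u + mk v := by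
  rw [mk, ← Uinf.mk_mul]
  rfl

lemma mk_eq_zero_iff {u : U A n} :
    mk u = 0 ↔ ∃ (N : ℕ) (h : n ≤ N), Joined 1 (stab A n N h u) := by
  refine (QuotientGroup.eq_one_iff (N := Uinf0 A) (Uinf.mk u)).trans ⟨?_, ?_⟩
  · rintro ⟨m, z, hz, he⟩
    obtain ⟨N, hm, hn, e⟩ : ∃ (N : ℕ) (hm : m ≤ N) (hn : n ≤ N),
        stab A m N hm z = stab A n N hn u := Quotient.exact he
    exact ⟨N, hn, e ▸ joined_one_stab hm hz⟩
  · rintro ⟨N, h, hj⟩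
    exact ⟨N, _, hj, Uinf.mk_stab h u⟩

lemma map_mk (φ : B →⋆ₐ[ℂ] A) (u : U B n) : K1.map φ (mk u) = mk (uMap φ n u) := rfl

end K1

/-- The net `f` in `K₁(B)` consists of the classes of unitaries which represent the image under
`ψ` of a unitary of class `x`. -/
def IsK1Lift (l : Filter ι) (ψ : ι → A →ₗ[ℂ] B) (x : K1 A) (f : ι → K1 B) : Prop :=
  ∃ (n : ℕ) (u : U A n) (u' : ι → U B n), K1.mk u = x ∧ (fun i => K1.mk (u' i)) = f ∧
    IsMatrixLift l ψ u.1 fun i => (u' i).1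

namespace IsAsympMorphism

variable (H : IsAsympMorphism l ψ)
include H

lemma exists_isK1Lift (x : K1 A) : ∃ f, IsK1Lift l ψ x f := by
  obtain ⟨n, u, rfl⟩ := K1.exists_mk x
  obtain ⟨u', hu'⟩ := H.exists_unitary_isMatrixLift u
  exact ⟨_, n, u, u', rfl, rfl, hu'⟩

lemma isK1Lift_add {x y : K1 A} {f g : ι → K1 B} (hx : IsK1Lift l ψ x f)
    (hy : IsK1Lift l ψ y g) : IsK1Lift l ψ (x + y) (f + g) := by
  obtain ⟨m, u, u', rfl, rfl, hu⟩ := hx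
  obtain ⟨n, v, v', rfl, rfl, hv⟩ := hy
  refine ⟨max m n, _, _, ?_, ?_, H.isMatrixLift_mul (hu.stab H (le_max_left m n))
    (hv.stab H (le_max_right m n))⟩
  · rw [K1.mk_mul, K1.mk_stab, K1.mk_stab]
  · ext i
    rw [K1.mk_mul, K1.mk_stab, K1.mk_stab, Pi.add_apply]

lemma isK1Lift_neg {x : K1 A} {f : ι → K1 B} (hx : IsK1Lift l ψ x f) :
    IsK1Lift l ψ (-x) (-f) := by
  obtain ⟨n, u, u', rfl, rfl, hu⟩ := hx
  exact ⟨n, u⁻¹, fun i => (u' i)⁻¹, rfl, rfl, H.isMatrixLift_inv hu⟩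

lemma eventuallyEq_zero_of_isK1Lift {f : ι → K1 B} (hf : IsK1Lift l ψ 0 f) : f =ᶠ[l] 0 := by
  obtain ⟨n, u, u', hu0, rfl, hu⟩ := hf
  obtain ⟨N, h, hj⟩ := K1.mk_eq_zero_iff.1 hu0
  filter_upwards [H.eventually_joined_one_of_isMatrixLift hj (hu.stab H h)] with i hi
  exact K1.mk_eq_zero_iff.2 ⟨N, h, hi⟩

lemma eventuallyEq_of_isK1Lift {x : K1 A} {f g : ι → K1 B} (hf : IsK1Lift l ψ x f)
    (hg : IsK1Lift l ψ x g) : f =ᶠ[l] g := by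
  have hsub : IsK1Lift l ψ 0 (f - g) := by
    simpa [sub_eq_add_neg] using H.isK1Lift_add hf (H.isK1Lift_neg hg)
  filter_upwards [H.eventuallyEq_zero_of_isK1Lift hsub] with i hi
  exact sub_eq_zero.1 hi

lemma exists_K1_germ : ∃ Λ : K1 A →+ l.Germ (K1 B), ∀ x f, IsK1Lift l ψ x f → Λ x = f := by
  refine exists_addMonoidHom_germ H.exists_isK1Lift (fun _ _ _ => H.eventuallyEq_of_isK1Lift)
    ?_ fun _ _ _ _ => H.isK1Lift_add
  obtain ⟨f, hf⟩ := H.exists_isK1Lift 0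
  simpa using H.isK1Lift_add hf (H.isK1Lift_neg hf)

end IsAsympMorphism

lemma IsAsympRetraction.isK1Lift_map (H : IsAsympRetraction l φ ψ) (x : K1 B) :
    IsK1Lift l ψ (K1.map φ x) fun _ => x := by
  obtain ⟨n, u, rfl⟩ := K1.exists_mk x
  exact ⟨n, uMap φ n u, fun _ => u, (K1.map_mk φ u).symm, rfl,
    fun r c => H.isAsympLift_map (u.1 r c)⟩

theorem IsAsympRetraction.isPureEmbedding_K1 [l.NeBot] (H : IsAsympRetraction l φ ψ) :
    IsPureEmbedding (K1.map φ) := by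
  obtain ⟨Λ, hΛ⟩ := H.exists_K1_germ
  exact isPureEmbedding_of_germ Λ fun x => hΛ _ _ (H.isK1Lift_map x)

end Lifts

end CStarK

/-! ### Spectral subspaces of circle representations -/

open CStarK MeasureTheory AddCircle

section SpectralSubspace

variable {E : Type*} [NormedAddCommGroup E] [NormedSpace ℂ E]

/-- The spectral subspace of degree `n` of a representation of the circle, on which `ζ` acts as
multiplication by `ζ ^ n`. -/
def spectralSubspace (π : Circle →* (E →L[ℂ] E)) (n : ℤ) : Submodule ℂ E where
  carrier := {x | ∀ ζ : Circle, π ζ x = ((ζ ^ n : Circle) : ℂ) • x}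
  add_mem' hx hy ζ := by rw [map_add, hx ζ, hy ζ, smul_add]
  zero_mem' ζ := by simp
  smul_mem' c x hx ζ := by rw [map_smul, hx ζ, smul_comm]

variable {π : Circle →* (E →L[ℂ] E)} (hπ : ∀ x, Continuous fun ζ => π ζ x)

lemma toCircle_surjective : Function.Surjective (toCircle : UnitAddCircle → Circle) := fun ζ => by
  obtain ⟨t, rfl⟩ := (homeomorphCircle (T := (1 : ℝ)) one_ne_zero).surjective ζ
  exact ⟨t, (homeomorphCircle_apply one_ne_zero t).symm⟩

include hπ in
lemma integrable_fourier_smul_orbit (n : ℤ) (x : E) :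
    Integrable (fun t : UnitAddCircle => fourier n t • π (toCircle t) x) haarAddCircle := by
  have horbit : Continuous fun t : UnitAddCircle => π (toCircle t) x :=
    (hπ x).comp continuous_toCircle
  exact ((fourier n).continuous.smul horbit).integrable_of_hasCompactSupport
    (HasCompactSupport.of_compactSpace _)

/-- The projection onto the spectral subspace of degree `n` of a strongly continuous representation
of the circle, which sends `x` to the `n`-th Fourier coefficient of its orbit map. -/
def spectralProjection (n : ℤ) : E →ₗ[ℂ] E where
  toFun x := ∫ t : UnitAddCircle, fourier (-n) t • π (toCircle t) x ∂haarAddCircle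
  map_add' x y := by
    simp only [map_add, smul_add]
    exact integral_add (integrable_fourier_smul_orbit hπ (-n) x)
      (integrable_fourier_smul_orbit hπ (-n) y)
  map_smul' c x := by
    simp only [map_smul, smul_comm _ c, integral_smul, RingHom.id_apply]

lemma spectralProjection_apply (n : ℤ) (x : E) : spectralProjection hπ n x =
    ∫ t : UnitAddCircle, fourier (-n) t • π (toCircle t) x ∂haarAddCircle := rfl

lemma map_spectralProjection [CompleteSpace E] {F : Type*} [NormedAddCommGroup F] [NormedSpace ℂ F]
    [CompleteSpace F] (T : E →L[ℂ] F) (n : ℤ) (x : E) : T (spectralProjection hπ n x) =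
      ∫ t : UnitAddCircle, fourier (-n) t • T (π (toCircle t) x) ∂haarAddCircle := by
  simpa only [map_smul, spectralProjection_apply] using
    (T.integral_comp_comm (integrable_fourier_smul_orbit hπ (-n) x)).symm

lemma spectralProjection_mem [CompleteSpace E] (n : ℤ) (x : E) :
    spectralProjection hπ n x ∈ spectralSubspace π n := fun ζ => by
  obtain ⟨s, rfl⟩ := toCircle_surjective ζ
  have hshift (t : UnitAddCircle) : fourier (-n) t • π (toCircle s) (π (toCircle t) x) =
      ((toCircle s ^ n : Circle) : ℂ) • (fourier (-n) (s + t) • π (toCircle (s + t)) x) := by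
    rw [smul_smul, toCircle_add, map_mul, mul_apply_eq_comp, fourier_apply,
      fourier_apply, ← Circle.coe_mul, toCircle_zsmul, toCircle_zsmul, toCircle_add, mul_zpow,
      ← mul_assoc, ← zpow_add, add_neg_cancel, zpow_zero, one_mul]
  rw [map_spectralProjection, spectralProjection_apply]
  simp_rw [hshift]
  rw [integral_smul, integral_add_left_eq_self
    (fun t : UnitAddCircle => fourier (-n) t • π (toCircle t) x) s]

lemma spectralProjection_of_mem [CompleteSpace E] {n : ℤ} {x : E} (hx : x ∈ spectralSubspace π n)
    (m : ℤ) : spectralProjection hπ m x = if m = n then x else 0 := by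
  have hcoeff := congrFun (fourierCoeff_fourier (T := (1 : ℝ)) n) m
  rw [fourierCoeff, Pi.single_apply] at hcoeff
  calc spectralProjection hπ m x
      = ∫ t : UnitAddCircle, (fourier (-m) t • fourier n t) • x ∂haarAddCircle := by
        refine integral_congr_ae (.of_forall fun t => ?_)
        simp only [hx (toCircle t), smul_assoc, fourier_apply (n := n), toCircle_zsmul]
    _ = if m = n then x else 0 := by
        rw [integral_smul_const, hcoeff, ite_smul, one_smul, zero_smul]

lemma norm_spectralProjection_sub_le [CompleteSpace E] {n : ℤ} {x : E} {ε : ℝ}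
    (hx : ∀ ζ, ‖π ζ x - ((ζ ^ n : Circle) : ℂ) • x‖ ≤ ε) :
    ‖spectralProjection hπ n x - x‖ ≤ ε := by
  have hsub : spectralProjection hπ n x - x =
      ∫ t : UnitAddCircle, (fourier (-n) t • π (toCircle t) x - x) ∂haarAddCircle := by
    rw [integral_sub (integrable_fourier_smul_orbit hπ (-n) x) (integrable_const x)]
    simp [spectralProjection_apply]
  rw [hsub]
  refine (norm_integral_le_of_norm_le_const (C := ε) (.of_forall fun t => ?_)).trans (by simp)
  have htwist : fourier (-n) t • π (toCircle t) x - x =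
      fourier (-n) t • (π (toCircle t) x - ((toCircle t ^ n : Circle) : ℂ) • x) := by
    rw [smul_sub, smul_smul, fourier_apply, ← Circle.coe_mul, toCircle_zsmul, ← zpow_add]
    simp
  rw [htwist, norm_smul, fourier_apply, Circle.norm_coe, one_mul]
  exact hx (toCircle t)

include hπ in
lemma topologicalClosure_iSup_spectralSubspace [CompleteSpace E] :
    (⨆ n, spectralSubspace π n).topologicalClosure = ⊤ := by
  set S := (⨆ n, spectralSubspace π n).topologicalClosure
  have hS : IsClosed (S : Set E) := Submodule.isClosed_topologicalClosure _
  have hle (n : ℤ) : spectralSubspace π n ≤ S :=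
    (le_iSup _ n).trans (Submodule.le_topologicalClosure _)
  refine eq_top_iff.2 fun x _ => (Submodule.Quotient.mk_eq_zero S).1 ?_
  refine SeparatingDual.eq_zero_of_forall_dual_eq_zero (R := ℂ) fun g => ?_
  -- A functional vanishing on all spectral subspaces has zero Fourier coefficients on every orbit.
  let T : E →L[ℂ] ℂ := g.comp S.mkQL
  let f : C(UnitAddCircle, ℂ) :=
    ⟨fun t => T (π (toCircle t) x), T.continuous.comp ((hπ x).comp continuous_toCircle)⟩
  have hT (n : ℤ) : T (spectralProjection hπ n x) = 0 := by
    have hmk : S.mkQL (spectralProjection hπ n x) = 0 :=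
      (Submodule.Quotient.mk_eq_zero S).2 (hle n (spectralProjection_mem hπ n x))
    rw [ContinuousLinearMap.comp_apply, hmk, map_zero]
  have hf : fourierCoeff f = 0 :=
    funext fun n => (map_spectralProjection hπ T n x).symm.trans (hT n)
  have hsum := has_pointwise_sum_fourier_series_of_summable (f := f)
    (by rw [hf]; exact summable_zero) 0
  simp only [hf, Pi.zero_apply, zero_smul] at hsum
  simpa [f, T] using hsum.unique hasSum_zero

end SpectralSubspace

/-! ### Circle actions with the Rokhlin property -/

section CircleAction

variable {A : Type*} [CStarAlgebra A]

/-- An action of the circle by automorphisms, regarded as a representation on the underlying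
Banach space. -/
def actionRep (α : Circle →* (A ≃⋆ₐ[ℂ] A)) : Circle →* (A →L[ℂ] A) where
  toFun ζ := ⟨(α ζ : A →ₗ[ℂ] A), (NonUnitalStarAlgHom.isometry (α ζ) (α ζ).injective).continuous⟩
  map_one' := by ext; simp
  map_mul' ζ ξ := by ext a; exact congrArg (· a) (map_mul α ζ ξ)

variable {α : Circle →* (A ≃⋆ₐ[ℂ] A)}

lemma actionRep_apply (ζ : Circle) (a : A) : actionRep α ζ a = α ζ a := rfl

lemma mem_spectralSubspace_actionRep {n : ℤ} {a : A} : a ∈ spectralSubspace (actionRep α) n ↔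
    ∀ ζ : Circle, α ζ a = ((ζ ^ n : Circle) : ℂ) • a := Iff.rfl

lemma mul_mem_spectralSubspace {m n : ℤ} {a b : A} (ha : a ∈ spectralSubspace (actionRep α) m)
    (hb : b ∈ spectralSubspace (actionRep α) n) :
    a * b ∈ spectralSubspace (actionRep α) (m + n) := fun ζ => by
  rw [actionRep_apply, map_mul, mem_spectralSubspace_actionRep.1 ha,
    mem_spectralSubspace_actionRep.1 hb, smul_mul_smul_comm, zpow_add, Circle.coe_mul]

lemma star_mem_spectralSubspace {n : ℤ} {a : A} (ha : a ∈ spectralSubspace (actionRep α) n) :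
    star a ∈ spectralSubspace (actionRep α) (-n) := fun ζ => by
  rw [actionRep_apply, map_star, mem_spectralSubspace_actionRep.1 ha, star_smul, zpow_neg,
    Circle.coe_inv_eq_conj, starRingEnd_apply]

lemma one_mem_spectralSubspace : (1 : A) ∈ spectralSubspace (actionRep α) 0 := fun ζ => by
  simp [actionRep_apply]

lemma pow_mem_spectralSubspace {n : ℤ} {a : A} (ha : a ∈ spectralSubspace (actionRep α) n)
    (k : ℕ) : a ^ k ∈ spectralSubspace (actionRep α) (k * n) := by
  induction k with
  | zero => simpa using one_mem_spectralSubspace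
  | succ k ih => simpa [pow_succ, add_mul] using mul_mem_spectralSubspace ih ha

lemma mem_fixedPointAlgebra_iff_mem_spectralSubspace_zero {a : A} :
    a ∈ fixedPointAlgebra α ↔ a ∈ spectralSubspace (actionRep α) 0 := by
  have hfix : a ∈ fixedPointAlgebra α ↔ ∀ ζ, α ζ a = a := Iff.rfl
  simp [hfix, mem_spectralSubspace_actionRep]

lemma polar_mem_spectralSubspace {n : ℤ} {x : A} (hx : x ∈ spectralSubspace (actionRep α) n)
    (hu : IsUnit x) : polar x ∈ spectralSubspace (actionRep α) n := fun ζ => by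
  rw [actionRep_apply, map_polar (α ζ) hu, mem_spectralSubspace_actionRep.1 hx,
    polar_smul (Circle.norm_coe _)]

lemma tendsto_star_mul_self_of_unitary {ι : Type*} {l : Filter ι} {u x : ι → A}
    (hu : ∀ i, u i ∈ unitary A) (h : Tendsto (fun i => x i - u i) l (𝓝 0)) :
    Tendsto (fun i => star (x i) * x i) l (𝓝 1) := by
  have hone : Tendsto (fun i => star (u i) * x i) l (𝓝 1) := by
    refine tendsto_sub_nhds_zero_iff.1 (squeeze_zero_norm (fun i => le_of_eq ?_)
      (tendsto_zero_iff_norm_tendsto_zero.1 h))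
    rw [← CStarRing.norm_mem_unitary_mul _ (hu i), mul_sub, ← mul_assoc,
      Unitary.mul_star_self_of_mem (hu i), one_mul, mul_one]
  refine (hone.star.mul hone).congr (fun i => ?_) |>.trans (by simp)
  rw [star_mul, star_star, mul_assoc, ← mul_assoc (u i), Unitary.mul_star_self_of_mem (hu i),
    one_mul]

variable (hα : ∀ a, Continuous fun ζ => actionRep α ζ a)
include hα

-- The degree one components of almost equivariant unitaries are almost unitary, and their polar
-- parts remain in degree one.
lemma HasRokhlinProperty.exists_unitary_mem_spectralSubspace (hR : HasRokhlinProperty α) {ε : ℝ}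
    (hε : 0 < ε) (F : Finset A) :
    ∃ u ∈ unitary A, u ∈ spectralSubspace (actionRep α) 1 ∧ ∀ a ∈ F, ‖u * a - a * u‖ < ε := by
  choose u hu hrot hcomm using fun k : ℕ => hR (1 / (k + 1)) Nat.one_div_pos_of_nat F
  let x (k : ℕ) : A := spectralProjection hα 1 (u k)
  have hε₀ : Tendsto (fun k : ℕ => 1 / ((k : ℝ) + 1)) atTop (𝓝 0) :=
    tendsto_one_div_add_atTop_nhds_zero_nat
  have hxu : Tendsto (fun k => x k - u k) atTop (𝓝 0) :=
    squeeze_zero_norm (fun k => norm_spectralProjection_sub_le hα fun ζ => by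
      simpa [actionRep_apply] using (hrot k ζ).le) hε₀
  have hx : Tendsto (fun k => star (x k) * x k) atTop (𝓝 1) :=
    tendsto_star_mul_self_of_unitary hu hxu
  have hx' : Tendsto (fun k => x k * star (x k)) atTop (𝓝 1) := by
    simpa only [star_star] using tendsto_star_mul_self_of_unitary (x := fun k => star (x k))
      (fun k => Unitary.star_mem (hu k)) (by simpa only [star_sub, star_zero] using hxu.star)
  have hpolar : Tendsto (fun k => polar (x k) - u k) atTop (𝓝 0) := by
    simpa using (tendsto_polar_sub hx hx').add hxu
  have hsmall : ∀ a ∈ F, ∀ᶠ k in atTop,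
      ‖polar (x k) * a - a * polar (x k)‖ < ε := fun a ha => by
    have hua : Tendsto (fun k => u k * a - a * u k) atTop (𝓝 0) :=
      squeeze_zero_norm (fun k => (hcomm k a ha).le) hε₀
    have hpa := ((hpolar.mul_const a).sub (hpolar.const_mul a)).add hua
    simp only [zero_mul, mul_zero, sub_zero, add_zero, sub_mul, mul_sub] at hpa
    refine (tendsto_zero_iff_norm_tendsto_zero.1 hpa).eventually_lt_const hε |>.mono fun k hk => ?_
    refine (congrArg norm ?_).trans_lt hk
    abel
  obtain ⟨k, hk, hunit⟩ :=
    (((Finset.eventually_all F).2 hsmall).and (eventually_isUnit hx hx')).exists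
  exact ⟨polar (x k), polar_mem_unitary hunit,
    polar_mem_spectralSubspace (spectralProjection_mem hα 1 (u k)) hunit, hk⟩

end CircleAction

/-! ### Averaged compressions -/

section Density

variable {ι κ E F : Type*} [NormedAddCommGroup E] [NormedSpace ℂ E] [NormedAddCommGroup F]
  [NormedSpace ℂ F] {l : Filter ι}

lemma tendsto_zero_of_topologicalClosure_iSup_eq_top {Θ : ι → E →ₗ[ℂ] F} {C : ℝ}
    (hC : ∀ i x, ‖Θ i x‖ ≤ C * ‖x‖) {D : κ → Submodule ℂ E}
    (hD : (⨆ k, D k).topologicalClosure = ⊤)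
    (h : ∀ k, ∀ x ∈ D k, Tendsto (fun i => Θ i x) l (𝓝 0)) (x : E) :
    Tendsto (fun i => Θ i x) l (𝓝 0) := by
  let S : Submodule ℂ E :=
    { carrier := {x | Tendsto (fun i => Θ i x) l (𝓝 0)}
      add_mem' := fun hx hy => by simpa using Tendsto.add hx hy
      zero_mem' := by simpa using tendsto_const_nhds
      smul_mem' := fun c x hx => by simpa using Tendsto.const_smul hx c }
  have hequi : Equicontinuous fun i => (Θ i : E → F) :=
    (LipschitzWith.uniformEquicontinuous _ C.toNNReal fun i =>
      AddMonoidHomClass.lipschitz_of_bound (Θ i) C (hC i)).equicontinuous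
  have hclosed : IsClosed (S : Set E) := hequi.isClosed_setOfPred_tendsto continuous_const
  have hle : (⨆ k, D k).topologicalClosure ≤ S :=
    Submodule.topologicalClosure_minimal _ (iSup_le fun k x hx => h k x hx) hclosed
  exact hle (hD ▸ Submodule.mem_top)

end Density

lemma tendsto_map_mul_sub_of_topologicalClosure_iSup_eq_top {ι κ A B : Type*} [CStarAlgebra A]
    [CStarAlgebra B] {l : Filter ι} {ψ : ι → A →ₗ[ℂ] B} {C : ℝ} (hψ : ∀ i a, ‖ψ i a‖ ≤ C * ‖a‖)
    {D : κ → Submodule ℂ A} (hD : (⨆ k, D k).topologicalClosure = ⊤)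
    (h : ∀ m n, ∀ a ∈ D m, ∀ b ∈ D n, Tendsto (fun i => ψ i (a * b) - ψ i a * ψ i b) l (𝓝 0))
    (a b : A) : Tendsto (fun i => ψ i (a * b) - ψ i a * ψ i b) l (𝓝 0) := by
  have hψ' (i : ι) (a : A) : ‖ψ i a‖ ≤ |C| * ‖a‖ :=
    (hψ i a).trans (by gcongr; exact le_abs_self C)
  have hbound (i : ι) (a b : A) :
      ‖ψ i (a * b) - ψ i a * ψ i b‖ ≤ (|C| + |C| * |C|) * (‖a‖ * ‖b‖) := by
    calc ‖ψ i (a * b) - ψ i a * ψ i b‖ ≤ ‖ψ i (a * b)‖ + ‖ψ i a‖ * ‖ψ i b‖ :=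
          (norm_sub_le _ _).trans (add_le_add_right (norm_mul_le _ _) _)
      _ ≤ |C| * (‖a‖ * ‖b‖) + |C| * ‖a‖ * (|C| * ‖b‖) := by
          gcongr
          · exact (hψ' i (a * b)).trans (by gcongr; exact norm_mul_le a b)
          · exact hψ' i a
          · exact hψ' i b
      _ = (|C| + |C| * |C|) * (‖a‖ * ‖b‖) := by ring
  have hleft (m : κ) (a : A) (ha : a ∈ D m) (b : A) :
      Tendsto (fun i => ψ i (a * b) - ψ i a * ψ i b) l (𝓝 0) :=
    tendsto_zero_of_topologicalClosure_iSup_eq_top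
      (Θ := fun i => ψ i ∘ₗ LinearMap.mulLeft ℂ a - LinearMap.mulLeft ℂ (ψ i a) ∘ₗ ψ i)
      (fun i x => (hbound i a x).trans_eq (mul_assoc _ _ _).symm) hD
      (fun n x hx => h m n a ha x hx) b
  exact tendsto_zero_of_topologicalClosure_iSup_eq_top
    (Θ := fun i => ψ i ∘ₗ LinearMap.mulRight ℂ b - LinearMap.mulRight ℂ (ψ i b) ∘ₗ ψ i)
    (fun i x => (hbound i x b).trans_eq (by rw [mul_comm ‖x‖, ← mul_assoc])) hD
    (fun m x hx => hleft m x hx b) a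

section RokhlinMap

variable {A : Type*} [CStarAlgebra A]

lemma norm_zpow_mul_sub_mul_zpow_le (u : unitary A) (a : A) (n : ℤ) :
    ‖((u ^ n : unitary A) : A) * a - a * (u ^ n : unitary A)‖ ≤
      n.natAbs * ‖(u : A) * a - a * u‖ := by
  have hpow (k : ℕ) : ‖((u ^ k : unitary A) : A) * a - a * (u ^ k : unitary A)‖ ≤
      k * ‖(u : A) * a - a * u‖ := by
    induction k with
    | zero => simp
    | succ k ih =>
      have hsplit : ((u ^ (k + 1) : unitary A) : A) * a - a * (u ^ (k + 1) : unitary A) =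
          (u ^ k : unitary A) * ((u : A) * a - a * u) +
            (((u ^ k : unitary A) : A) * a - a * (u ^ k : unitary A)) * u := by
        rw [pow_succ, Submonoid.coe_mul]
        noncomm_ring
      rw [hsplit, Nat.cast_add_one, add_one_mul, add_comm (_ * _ : ℝ)]
      refine (norm_add_le _ _).trans (add_le_add (CStarRing.norm_coe_unitary_mul _ _).le ?_)
      rwa [CStarRing.norm_mul_coe_unitary]
  have hinv (w : unitary A) : ‖((w⁻¹ : unitary A) : A) * a - a * (w⁻¹ : unitary A)‖ =
      ‖(w : A) * a - a * w‖ := by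
    have hconj : (w : A) * (((w⁻¹ : unitary A) : A) * a - a * (w⁻¹ : unitary A)) * w =
        -((w : A) * a - a * w) := by
      have hw : (w : A) * (w⁻¹ : unitary A) = 1 := Unitary.mul_star_self_of_mem w.2
      have hw' : ((w⁻¹ : unitary A) : A) * w = 1 := Unitary.star_mul_self_of_mem w.2
      rw [mul_sub, sub_mul, ← mul_assoc, hw, one_mul, mul_assoc, mul_assoc a, hw', mul_one, neg_sub]
    rw [← norm_neg ((w : A) * a - a * w), ← hconj, CStarRing.norm_mul_coe_unitary,
      CStarRing.norm_coe_unitary_mul]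
  obtain ⟨k, rfl | rfl⟩ := n.eq_nat_or_neg
  · simpa using hpow k
  · simpa [hinv] using hpow k

lemma norm_map_le_four_mul {B : Type*} [CStarAlgebra B] [PartialOrder A] [StarOrderedRing A]
    [PartialOrder B] [StarOrderedRing B] (f : A →ₚ[ℂ] B) (a : A) : ‖f a‖ ≤ 4 * ‖f 1‖ * ‖a‖ := by
  obtain ⟨y, hy, hya, hsum⟩ := CStarAlgebra.exists_sum_four_nonneg a
  calc ‖f a‖ = ‖∑ i : Fin 4, Complex.I ^ i.val • f (y i)‖ := by
        conv_lhs => rw [hsum]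
        simp only [map_sum, map_smul]
    _ ≤ ∑ i : Fin 4, ‖Complex.I ^ i.val • f (y i)‖ := norm_sum_le _ _
    _ = ∑ i, ‖f (y i)‖ := by simp only [norm_smul, norm_pow, Complex.norm_I, one_pow, one_mul]
    _ ≤ ∑ _i : Fin 4, ‖f 1‖ * ‖a‖ := Finset.sum_le_sum fun i _ =>
        (f.norm_apply_le_of_nonneg _ (hy i)).trans (by gcongr; exact hya i)
    _ = 4 * ‖f 1‖ * ‖a‖ := by simp [mul_assoc]

variable {α : Circle →* (A ≃⋆ₐ[ℂ] A)} (hα : ∀ a, Continuous fun ζ => actionRep α ζ a)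

lemma spectralProjection_zero_apply (a : A) : spectralProjection hα 0 a =
    ∫ t : UnitAddCircle, α (toCircle t) a ∂haarAddCircle := by
  simp [spectralProjection_apply, actionRep_apply]

lemma spectralProjection_zero_mem_fixedPointAlgebra (a : A) :
    spectralProjection hα 0 a ∈ fixedPointAlgebra α :=
  mem_fixedPointAlgebra_iff_mem_spectralSubspace_zero.2 (spectralProjection_mem hα 0 a)

lemma spectralProjection_zero_star (a : A) :
    spectralProjection hα 0 (star a) = star (spectralProjection hα 0 a) := by
  have hint : Integrable (fun t : UnitAddCircle => α (toCircle t) a) haarAddCircle := by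
    simpa [actionRep_apply] using integrable_fourier_smul_orbit hα 0 a
  simpa [spectralProjection_zero_apply, map_star] using
    (starL' ℝ : A ≃L[ℝ] A).toContinuousLinearMap.integral_comp_comm hint

lemma spectralProjection_zero_nonneg [PartialOrder A] [StarOrderedRing A] {a : A} (ha : 0 ≤ a) :
    0 ≤ spectralProjection hα 0 a := by
  rw [spectralProjection_zero_apply]
  exact integral_nonneg fun t => map_nonneg (α (toCircle t)) ha

/-- The compression of `a` by `∑ k < N, (u⋆) ^ k`, averaged over the circle action and normalized
by `N`. For a unitary `u` of degree one this is a unital completely positive map which, on an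
element of degree `n` almost commuting with `u`, is close to `a ↦ u ^ (-n) * a` as `N` grows. -/
def rokhlinMap (u : A) (N : ℕ) : A →ₗ[ℂ] fixedPointAlgebra α where
  toFun a := ⟨(N : ℂ)⁻¹ • spectralProjection hα 0
      ((∑ k ∈ Finset.range N, star u ^ k) * a * star (∑ k ∈ Finset.range N, star u ^ k)),
    (fixedPointAlgebra α).smul_mem (spectralProjection_zero_mem_fixedPointAlgebra hα _) _⟩
  map_add' a b := Subtype.ext (by simp [mul_add, add_mul])
  map_smul' c a := Subtype.ext (by simp [smul_comm c])

lemma coe_rokhlinMap (u : A) (N : ℕ) (a : A) : (rokhlinMap hα u N a : A) =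
    (N : ℂ)⁻¹ • spectralProjection hα 0
      ((∑ k ∈ Finset.range N, star u ^ k) * a * star (∑ k ∈ Finset.range N, star u ^ k)) := rfl

lemma rokhlinMap_star (u : A) (N : ℕ) (a : A) :
    rokhlinMap hα u N (star a) = star (rokhlinMap hα u N a) := by
  apply Subtype.ext
  rw [StarMemClass.coe_star, coe_rokhlinMap, coe_rokhlinMap, star_smul,
    ← spectralProjection_zero_star]
  simp [mul_assoc]

lemma spectralProjection_zero_compression {u : A} (hu : u ∈ spectralSubspace (actionRep α) 1)
    {n : ℤ} {a : A} (ha : a ∈ spectralSubspace (actionRep α) n) (N : ℕ) :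
    spectralProjection hα 0
      ((∑ k ∈ Finset.range N, star u ^ k) * a * star (∑ k ∈ Finset.range N, star u ^ k)) =
      ∑ l ∈ Finset.range N, ∑ k ∈ Finset.range N,
        if (k : ℤ) = n + l then star u ^ k * a * u ^ l else 0 := by
  simp only [star_sum, star_pow, star_star, Finset.mul_sum, Finset.sum_mul, map_sum]
  refine Finset.sum_congr rfl fun l _ => Finset.sum_congr rfl fun k _ => ?_
  have hdeg := mul_mem_spectralSubspace (mul_mem_spectralSubspace
    (pow_mem_spectralSubspace (star_mem_spectralSubspace hu) k) ha) (pow_mem_spectralSubspace hu l)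
  rw [spectralProjection_of_mem hα hdeg]
  exact if_congr (by omega) rfl rfl

lemma card_filter_not_exists_eq_add_le (N : ℕ) (n : ℤ) :
    {l ∈ Finset.range N | ¬∃ k < N, ((k : ℕ) : ℤ) = n + (l : ℕ)}.card ≤ n.natAbs := by
  rcases le_total 0 n with hn | hn
  · calc _ ≤ (Finset.Ico (N - n.natAbs) N).card := by
          refine Finset.card_le_card fun l hl => ?_
          simp only [Finset.mem_filter, Finset.mem_range, Finset.mem_Ico] at hl ⊢
          by_contra h
          exact hl.2 ⟨(n + l).toNat, by omega, by omega⟩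
      _ ≤ n.natAbs := by rw [Nat.card_Ico]; omega
  · calc _ ≤ (Finset.range n.natAbs).card := by
          refine Finset.card_le_card fun l hl => ?_
          simp only [Finset.mem_filter, Finset.mem_range] at hl ⊢
          by_contra h
          exact hl.2 ⟨(n + l).toNat, by omega, by omega⟩
      _ = n.natAbs := Finset.card_range _

lemma norm_star_pow_mul_mul_pow_sub_le (u : unitary A) (a : A) {k l : ℕ} {n : ℤ}
    (hkl : (k : ℤ) = n + l) :
    ‖star (u : A) ^ k * a * (u : A) ^ l - (u ^ (-n) : unitary A) * a‖ ≤
      l * ‖(u : A) * a - a * u‖ := by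
  have hu : u ^ (-n) = u⁻¹ ^ k * u ^ l := by
    rw [inv_pow, ← zpow_natCast, ← zpow_natCast, ← zpow_neg, ← zpow_add]
    congr 1
    omega
  have hsplit : star (u : A) ^ k * a * (u : A) ^ l - (u ^ (-n) : unitary A) * a =
      -((u⁻¹ ^ k : unitary A) * (((u ^ l : unitary A) : A) * a - a * (u ^ l : unitary A))) := by
    rw [hu, ← Unitary.star_eq_inv]
    push_cast
    noncomm_ring
  rw [hsplit, norm_neg, CStarRing.norm_coe_unitary_mul]
  simpa using norm_zpow_mul_sub_mul_zpow_le u a l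

lemma norm_sum_ite_star_pow_mul_mul_pow_sub_le (u : unitary A) (a : A) (n : ℤ) {l N : ℕ}
    (hl : l < N) :
    ‖(∑ k ∈ Finset.range N, if (k : ℤ) = n + l then star (u : A) ^ k * a * (u : A) ^ l else 0) -
        (u ^ (-n) : unitary A) * a‖ ≤
      N * ‖(u : A) * a - a * u‖ + if ¬∃ k < N, ((k : ℕ) : ℤ) = n + l then ‖a‖ else 0 := by
  by_cases h : ∃ k < N, (k : ℤ) = n + l
  · obtain ⟨k, hk, hkl⟩ := h
    rw [Finset.sum_eq_single_of_mem k (Finset.mem_range.2 hk) fun k' _ hk' => if_neg (by omega),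
      if_pos hkl, if_neg (not_not.2 ⟨k, hk, hkl⟩), add_zero]
    refine (norm_star_pow_mul_mul_pow_sub_le u a hkl).trans ?_
    gcongr
  · rw [Finset.sum_eq_zero fun k hk => if_neg fun hkl => h ⟨k, Finset.mem_range.1 hk, hkl⟩,
      zero_sub, norm_neg, CStarRing.norm_coe_unitary_mul, if_pos h]
    exact le_add_of_nonneg_left (by positivity)

lemma norm_rokhlinMap_sub_le {u : unitary A} (hu : (u : A) ∈ spectralSubspace (actionRep α) 1)
    {n : ℤ} {a : A} (ha : a ∈ spectralSubspace (actionRep α) n) {N : ℕ} (hN : N ≠ 0) :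
    ‖(rokhlinMap hα u N a : A) - (u ^ (-n) : unitary A) * a‖ ≤
      N * ‖(u : A) * a - a * u‖ + n.natAbs * ‖a‖ / N := by
  set c := ‖(u : A) * a - a * u‖
  let b (l : ℕ) : A :=
    ∑ k ∈ Finset.range N, if (k : ℤ) = n + l then star (u : A) ^ k * a * (u : A) ^ l else 0
  have hN' : (N : ℂ) ≠ 0 := Nat.cast_ne_zero.2 hN
  have hsum : (rokhlinMap hα u N a : A) - (u ^ (-n) : unitary A) * a =
      (N : ℂ)⁻¹ • ∑ l ∈ Finset.range N, (b l - (u ^ (-n) : unitary A) * a) := by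
    rw [coe_rokhlinMap, spectralProjection_zero_compression hα hu ha, Finset.sum_sub_distrib,
      smul_sub, Finset.sum_const, Finset.card_range, ← Nat.cast_smul_eq_nsmul ℂ,
      inv_smul_smul₀ hN']
  calc ‖(rokhlinMap hα u N a : A) - (u ^ (-n) : unitary A) * a‖
      = (N : ℝ)⁻¹ * ‖∑ l ∈ Finset.range N, (b l - (u ^ (-n) : unitary A) * a)‖ := by
        rw [hsum, norm_smul, norm_inv, Complex.norm_natCast]
    _ ≤ (N : ℝ)⁻¹ * (N * (N * c) + n.natAbs * ‖a‖) := by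
        gcongr
        refine (norm_sum_le_of_le _ fun l hl =>
          norm_sum_ite_star_pow_mul_mul_pow_sub_le u a n (Finset.mem_range.1 hl)).trans ?_
        rw [Finset.sum_add_distrib, Finset.sum_const, Finset.card_range, nsmul_eq_mul,
          ← Finset.sum_filter, Finset.sum_const, nsmul_eq_mul]
        gcongr
        exact card_filter_not_exists_eq_add_le N n
    _ = N * c + n.natAbs * ‖a‖ / N := by field_simp

lemma rokhlinMap_one {u : unitary A} (hu : (u : A) ∈ spectralSubspace (actionRep α) 1) {N : ℕ}
    (hN : N ≠ 0) : rokhlinMap hα u N 1 = 1 := by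
  refine Subtype.ext (sub_eq_zero.1 (norm_le_zero_iff.1 ?_))
  simpa using norm_rokhlinMap_sub_le hα hu one_mem_spectralSubspace hN

lemma rokhlinMap_nonneg [PartialOrder A] [StarOrderedRing A] (u : A) (N : ℕ) {a : A}
    (ha : 0 ≤ a) : 0 ≤ (rokhlinMap hα u N a : A) := by
  have h := smul_nonneg (inv_nonneg.2 (Nat.cast_nonneg (α := ℝ) N))
    (spectralProjection_zero_nonneg hα
      (star_right_conjugate_nonneg ha (∑ k ∈ Finset.range N, star u ^ k)))
  rw [← Complex.coe_smul] at h
  simpa [coe_rokhlinMap] using h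

lemma norm_rokhlinMap_le {u : unitary A} (hu : (u : A) ∈ spectralSubspace (actionRep α) 1) {N : ℕ}
    (hN : N ≠ 0) (a : A) : ‖rokhlinMap hα u N a‖ ≤ 4 * ‖(1 : A)‖ * ‖a‖ := by
  let _ := CStarAlgebra.spectralOrder A
  have _ := CStarAlgebra.spectralOrderedRing A
  let f : A →ₚ[ℂ] A := PositiveLinearMap.mk₀
    ((fixedPointAlgebra α).subtype.toAlgHom.toLinearMap ∘ₗ rokhlinMap hα u N)
    fun x hx => rokhlinMap_nonneg hα u N hx
  have hone : f 1 = 1 := congrArg Subtype.val (rokhlinMap_one hα hu hN)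
  calc ‖f a‖ ≤ 4 * ‖f 1‖ * ‖a‖ := norm_map_le_four_mul f a
    _ = 4 * ‖(1 : A)‖ * ‖a‖ := by rw [hone]

end RokhlinMap

section RokhlinNet

variable {A ι : Type*} [CStarAlgebra A] {α : Circle →* (A ≃⋆ₐ[ℂ] A)} {l : Filter ι}

/-- A net of unitaries `u i` of degree one that is asymptotically central, together with integers
`N i` tending to infinity so slowly that `rokhlinMap _ (u i) (N i)` is asymptotically
multiplicative. -/
structure IsRokhlinNet (α : Circle →* (A ≃⋆ₐ[ℂ] A)) (l : Filter ι) (u : ι → unitary A)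
    (N : ι → ℕ) : Prop where
  mem_spectralSubspace : ∀ i, (u i : A) ∈ spectralSubspace (actionRep α) 1
  ne_zero : ∀ i, N i ≠ 0
  tendsto_atTop : Tendsto N l atTop
  tendsto_mul_norm : ∀ a : A, Tendsto (fun i => N i * ‖(u i : A) * a - a * u i‖) l (𝓝 0)

lemma HasRokhlinProperty.exists_isRokhlinNet (hα : ∀ a, Continuous fun ζ => actionRep α ζ a)
    (hR : HasRokhlinProperty α) :
    ∃ (u : Finset A × ℕ → unitary A) (N : Finset A × ℕ → ℕ), IsRokhlinNet α atTop u N := by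
  choose u hu hdeg hcomm using fun j : Finset A × ℕ =>
    hR.exists_unitary_mem_spectralSubspace hα (ε := 1 / ((j.2 : ℝ) + 1) ^ 2) (by positivity) j.1
  have hsnd : Tendsto (Prod.snd : Finset A × ℕ → ℕ) atTop atTop := by
    rw [← prod_atTop_atTop_eq]
    exact tendsto_snd
  refine ⟨fun j => ⟨u j, hu j⟩, fun j => j.2 + 1, hdeg, fun j => j.2.succ_ne_zero,
    (tendsto_add_atTop_nat 1).comp hsnd, fun a => ?_⟩
  refine squeeze_zero' (.of_forall fun j => by positivity) ?_
    (tendsto_one_div_add_atTop_nhds_zero_nat (𝕜 := ℝ).comp hsnd)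
  filter_upwards [eventually_ge_atTop (({a} : Finset A), 0)] with j hj
  have haj := (hcomm j a (hj.1 (Finset.mem_singleton_self a))).le
  calc ((j.2 + 1 : ℕ) : ℝ) * ‖u j * a - a * u j‖
      ≤ (j.2 + 1) * (1 / ((j.2 : ℝ) + 1) ^ 2) := by
        push_cast
        gcongr
    _ = 1 / ((j.2 : ℝ) + 1) := by field_simp

namespace IsRokhlinNet

variable {u : ι → unitary A} {N : ι → ℕ} (H : IsRokhlinNet α l u N)
include H

lemma tendsto_zpow_mul_sub_mul_zpow (n : ℤ) (a : A) :
    Tendsto (fun i => ((u i ^ n : unitary A) : A) * a - a * (u i ^ n : unitary A)) l (𝓝 0) := by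
  have hbound := (H.tendsto_mul_norm a).const_mul (n.natAbs : ℝ)
  rw [mul_zero] at hbound
  refine squeeze_zero_norm (fun i => (norm_zpow_mul_sub_mul_zpow_le (u i) a n).trans ?_) hbound
  gcongr
  exact le_mul_of_one_le_left (norm_nonneg _)
    (Nat.one_le_cast.2 (Nat.one_le_iff_ne_zero.2 (H.ne_zero i)))

lemma tendsto_zpow_mul_sub_zpow_mul_mul_zpow_mul (m n : ℤ) (a b : A) :
    Tendsto (fun i => (u i ^ (-(m + n)) : unitary A) * (a * b) -
      (u i ^ (-m) : unitary A) * a * ((u i ^ (-n) : unitary A) * b)) l (𝓝 0) := by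
  have hzero := ((H.tendsto_zpow_mul_sub_mul_zpow (-n) a).mul_const b).norm
  rw [zero_mul, norm_zero] at hzero
  refine squeeze_zero_norm (fun i => le_of_eq ?_) hzero
  have hfactor : (u i ^ (-(m + n)) : unitary A) * (a * b) -
      (u i ^ (-m) : unitary A) * a * ((u i ^ (-n) : unitary A) * b) =
      (u i ^ (-m) : unitary A) *
        ((((u i ^ (-n) : unitary A) : A) * a - a * (u i ^ (-n) : unitary A)) * b) := by
    rw [neg_add, zpow_add, Submonoid.coe_mul]
    noncomm_ring
  rw [hfactor, CStarRing.norm_coe_unitary_mul]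

variable (hα : ∀ a, Continuous fun ζ => actionRep α ζ a)

lemma tendsto_rokhlinMap_sub {n : ℤ} {a : A} (ha : a ∈ spectralSubspace (actionRep α) n) :
    Tendsto (fun i => (rokhlinMap hα (u i) (N i) a : A) - (u i ^ (-n) : unitary A) * a) l
      (𝓝 0) := by
  have hbound := (H.tendsto_mul_norm a).add
    ((tendsto_const_div_atTop_nhds_zero_nat (n.natAbs * ‖a‖)).comp H.tendsto_atTop)
  rw [add_zero] at hbound
  exact squeeze_zero_norm
    (fun i => norm_rokhlinMap_sub_le hα (H.mem_spectralSubspace i) ha (H.ne_zero i)) hbound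

lemma tendsto_rokhlinMap_mul_sub_of_mem {m n : ℤ} {a b : A}
    (ha : a ∈ spectralSubspace (actionRep α) m) (hb : b ∈ spectralSubspace (actionRep α) n) :
    Tendsto (fun i => (rokhlinMap hα (u i) (N i) (a * b) : A) -
      rokhlinMap hα (u i) (N i) a * rokhlinMap hα (u i) (N i) b) l (𝓝 0) := by
  let ψ (i : ι) (x : A) : A := rokhlinMap hα (u i) (N i) x
  have hab := H.tendsto_rokhlinMap_sub hα (mul_mem_spectralSubspace ha hb)
  have hmul : Tendsto (fun i => ψ i a * ψ i b -
      (u i ^ (-m) : unitary A) * a * ((u i ^ (-n) : unitary A) * b)) l (𝓝 0) := by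
    have hbdd : IsBoundedUnder (· ≤ ·) l (norm ∘ fun i => ψ i b) :=
      isBoundedUnder_of ⟨_, fun i => norm_rokhlinMap_le hα (H.mem_spectralSubspace i)
        (H.ne_zero i) b⟩
    have hbdd' : IsBoundedUnder (· ≤ ·) l (norm ∘ fun i => ((u i ^ (-m) : unitary A) : A) * a) :=
      isBoundedUnder_of ⟨‖a‖, fun i => (CStarRing.norm_coe_unitary_mul _ a).le⟩
    have hsum := ((H.tendsto_rokhlinMap_sub hα ha).zero_mul_isBoundedUnder_le hbdd).add
      (isBoundedUnder_le_mul_tendsto_zero hbdd' (H.tendsto_rokhlinMap_sub hα hb))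
    rw [add_zero] at hsum
    refine hsum.congr fun i => ?_
    simp only [ψ, sub_mul, mul_sub]
    abel
  have htotal := (hab.sub hmul).add (H.tendsto_zpow_mul_sub_zpow_mul_mul_zpow_mul m n a b)
  rw [sub_zero, add_zero] at htotal
  refine htotal.congr fun i => ?_
  simp only [ψ]
  abel

lemma isAsympRetraction : IsAsympRetraction l (fixedPointAlgebra α).subtype
    fun i => rokhlinMap hα (u i) (N i) where
  map_star i a := rokhlinMap_star hα (u i) (N i) a
  exists_bound :=
    ⟨4 * ‖(1 : A)‖, fun i => norm_rokhlinMap_le hα (H.mem_spectralSubspace i) (H.ne_zero i)⟩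
  tendsto_mul := tendsto_map_mul_sub_of_topologicalClosure_iSup_eq_top
    (fun i => norm_rokhlinMap_le hα (H.mem_spectralSubspace i) (H.ne_zero i))
    (topologicalClosure_iSup_spectralSubspace hα) fun _ _ _ ha _ hb =>
      Topology.IsEmbedding.subtypeVal.tendsto_nhds_iff.2
        (H.tendsto_rokhlinMap_mul_sub_of_mem hα ha hb)
  tendsto_one := by
    simp only [rokhlinMap_one hα (H.mem_spectralSubspace _) (H.ne_zero _), tendsto_const_nhds]
  tendsto_map b := by
    have hb := H.tendsto_rokhlinMap_sub hα
      (mem_fixedPointAlgebra_iff_mem_spectralSubspace_zero.1 b.2)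
    simp only [neg_zero, zpow_zero, OneMemClass.coe_one, one_mul] at hb
    exact Topology.IsEmbedding.subtypeVal.tendsto_nhds_iff.2 (tendsto_sub_nhds_zero_iff.1 hb)

end IsRokhlinNet

end RokhlinNet

end

theorem mainTheorem7 {A : Type*} [CStarAlgebra A] (α : Circle →* (A ≃⋆ₐ[ℂ] A))
    (hα : ∀ a : A, Continuous fun ζ : Circle => α ζ a) (hR : HasRokhlinProperty α) :
    (Function.Injective (CStarK.K0.map (fixedPointAlgebra α).subtype) ∧
      Function.Injective (CStarK.K1.map (fixedPointAlgebra α).subtype)) ∧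
    (AddGroup.FG (CStarK.K0 A) →
      ∃ π : CStarK.K0 A →+ CStarK.K0 (fixedPointAlgebra α),
        π.comp (CStarK.K0.map (fixedPointAlgebra α).subtype) = AddMonoidHom.id _) ∧
    (AddGroup.FG (CStarK.K1 A) →
      ∃ π : CStarK.K1 A →+ CStarK.K1 (fixedPointAlgebra α),
        π.comp (CStarK.K1.map (fixedPointAlgebra α).subtype) = AddMonoidHom.id _) ∧
    (CStarK.K0.map (fixedPointAlgebra α).subtype).range.IsPure ∧
    (CStarK.K1.map (fixedPointAlgebra α).subtype).range.IsPure := by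
  classical
  obtain ⟨u, N, hnet⟩ := hR.exists_isRokhlinNet hα
  have H := hnet.isAsympRetraction hα
  have h0 := H.isPureEmbedding_K0
  have h1 := H.isPureEmbedding_K1
  exact ⟨⟨h0.injective, h1.injective⟩, fun _ => h0.exists_retraction,
    fun _ => h1.exists_retraction, h0.isPure_range, h1.isPure_range⟩
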